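/- Let $p\in(1,\infty)$. Let $(X,d)$ be a complete, separable, locally compact metric space with a Radon measure $\mu$. Write $B(x,r)$ for open balls, $CB=B(x,Cr)$ for $B=B(x,r)$, and $f_B=\frac1{\mu(B)}\int_B f\,d\mu$. Only balls $B$ with $0<\mathrm{rad}(B)\le 2\,\mathrm{diam}(X)$ are considered (no upper restriction if $X$ is unbounded). A regular local $p$-Dirichlet structure on $(X,d,\mu)$ is a linear subspace $\mathcal F_p\subset L^p(X,\mu)$ together with a finite Borel measure $\Gamma_p\langle f\rangle$ for each $f\in\mathcal F_p$ such that, with $\mathcal E_p(f)=\Gamma_p\langle f\rangle(X)$: (i) $\mathcal F_p$ is a Banach space with the norm $\|f\|_{\mathcal F_p}=(\|f\|_{L^p}^p+\mathcal E_p(f))^{1/p}$; (ii) $\Gamma_p\langle\lambda f\rangle=|\lambda|^p\,\Gamma_p\langle f\rangle$ for $\lambda\in\mathbb R$; (iii) $\Gamma_p\langle f+g\rangle(A)^{1/p}\le\Gamma_p\langle f\rangle(A)^{1/p}+\Gamma_p\langle g\rangle(A)^{1/p}$ for Borel $A$; (iv) if $g:\mathbb R\to\mathbb R$ is $L$-Lipschitz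 with $g(0)=0$ and $f\in\mathcal F_p$, then $g\circ f\in\mathcal F_p$ and $\Gamma_p\langle g\circ f\rangle\le L^p\,\Gamma_p\langle f\rangle$; (v) if $A$ is open and $f\in\mathcal F_p$ is $\mu$-a.e. equal to a constant on $A$, then $\Gamma_p\langle f\rangle(A)=0$; (vi) if $f_i\in\mathcal F_p$, $f_i\to f$ in $L^p$ and $\sup_i\mathcal E_p(f_i)<\infty$, then $f\in\mathcal F_p$ and $\Gamma_p\langle f\rangle(A)\le\liminf_i\Gamma_p\langle f_i\rangle(A)$ for every Borel $A$; (vii) $C_c(X)\cap\mathcal F_p$ is dense in $\mathcal F_p$ for $\|\cdot\|_{\mathcal F_p}$ and in $C_c(X)$ for the supremum norm. Let $\Psi:X\times[0,\infty)\to[0,\infty)$ be a regular scale function with constant $C_\Psi>0$ and exponents $\beta_\pm>0$, i.e. $\Psi(x,0)=0$, $\Psi(x,r)>0$ for $r>0$, and for all $x,y\in X$, $0<s\le r\le 2\,\mathrm{diam}(X)$, with $R=d(x,y)$, $$C_\Psi^{-1}\Big(\frac{r}{r\vee R}\Big)^{\beta_+}\Big(\frac{r\vee R}{s}\Big)^{\beta_-}\le\frac{\Psi(x,r)}{\Psi(y,s)}\le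 C_\Psi\Big(\frac{r}{r\vee R}\Big)^{\beta_-}\Big(\frac{r\vee R}{s}\Big)^{\beta_+}.$$ Write $\Psi(B)=\Psi(x,r)$ for $B=B(x,r)$. Assume: - (doubling) $\mu(2B)\le C_D\,\mu(B)$ for all balls $B$ (here of any radius $r>0$); - ($\mathrm{Cap}_p(\Psi)$) for every ball $B$ there is $\psi_B\in C(X)\cap\mathcal F_p$ with $\psi_B=1$ on $B$, $\psi_B=0$ on $X\setminus 2B$ and $\Gamma_p\langle\psi_B\rangle(X)=\Gamma_p\langle\psi_B\rangle(2B)\le C_{\rm cap}\,\mu(B)/\Psi(B)$; - ($\mathrm{PI}_p(\Psi)$) for every ball $B$ and $f\in\mathcal F_p$, $\displaystyle\frac{1}{\mu(B)}\int_B|f-f_B|^p\,d\mu\le C_{\rm PI}\,\frac{\Psi(B)}{\mu(B)}\,\Gamma_p\langle f\rangle(\Lambda B)$, with $\Lambda>0$. Then for every $\eta\in(0,1)$ there is a constant $C_{\rm WB}>0$, depending only on $p,\eta,C_{\rm cap},C_D,C_{\rm PI},\Lambda,C_\Psi,\beta_-,\beta_+$, such that for all $f,g\in\mathcal F_p$ and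 every ball $B_0$ there is $h\in\mathcal F_p$ with $h=f$ $\mu$-a.e. on $B_0$, $h=g$ $\mu$-a.e. on $X\setminus(1+\eta)B_0$, and $$\Gamma_p\langle h\rangle(2B_0)\le C_{\rm WB}\,\frac{\mu(B_0)}{\Psi(B_0)}\cdot\frac{1}{\mu((1+\eta)B_0)}\int_{(1+\eta)B_0}|f-g|^p\,d\mu+C_{\rm WB}\,\Gamma_p\langle f\rangle(2B_0)+C_{\rm WB}\,\Gamma_p\langle g\rangle(2B_0).$$ -/

import Mathlib

open MeasureTheory Set Filter Topology
open scoped ENNReal NNReal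

noncomputable section

/-- The data of a `p`-energy on a metric measure space: a linear space `domain` of elements
of `L^p(X, μ)` (equivalence classes of functions modulo `μ`-a.e. equality), and for every `f` in
it a finite Borel measure `Γ f`, the energy measure of `f`. -/
structure PEnergy {X : Type*} [MetricSpace X] [MeasurableSpace X] [BorelSpace X]
    (μ : Measure X) (p : ℝ) where
  domain : Submodule ℝ (Lp ℝ (ENNReal.ofReal p) μ)
  Γ : domain → Measure X
  finite : ∀ f : domain, IsFiniteMeasure (Γ f)

namespace PEnergy

variable {X : Type*} [MetricSpace X] [MeasurableSpace X] [BorelSpace X]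
  {μ : Measure X} {p : ℝ}

/-- The total energy `Γ⟨f⟩(X)`, a finite non-negative real. -/
def energy (D : PEnergy μ p) (f : D.domain) : ℝ := (D.Γ f).real univ

/-- The norm `(‖f‖_{L^p}^p + Γ⟨f⟩(X))^{1/p}` on the domain. -/
def domainNorm (D : PEnergy μ p) (f : D.domain) : ℝ :=
  (‖(f : Lp ℝ (ENNReal.ofReal p) μ)‖ ^ p + D.energy f) ^ (1 / p)

/-- `φ : X → ℝ` is a representative of the class `f`. -/
def IsRep (D : PEnergy μ p) (f : D.domain) (φ : X → ℝ) : Prop :=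
  ((f : Lp ℝ (ENNReal.ofReal p) μ) : X → ℝ) =ᵐ[μ] φ

end PEnergy

/-- A regular local `p`-Dirichlet structure on `(X, d, μ)`. -/
structure PDirichletSpace {X : Type*} [MetricSpace X] [MeasurableSpace X] [BorelSpace X]
    (μ : Measure X) (p : ℝ) extends PEnergy μ p where
  /-- The domain is complete for `domainNorm`. (That `domainNorm` is a norm follows from
  `homogeneity` and `triangle`.) -/
  complete : ∀ u : ℕ → toPEnergy.domain,
    (∀ ε : ℝ, 0 < ε → ∃ N : ℕ, ∀ m n : ℕ, N ≤ m → N ≤ n →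
      toPEnergy.domainNorm (u m - u n) < ε) →
    ∃ f : toPEnergy.domain, Tendsto (fun n => toPEnergy.domainNorm (u n - f)) atTop (𝓝 0)
  homogeneity : ∀ (c : ℝ) (f : toPEnergy.domain),
    toPEnergy.Γ (c • f) = ENNReal.ofReal (|c| ^ p) • toPEnergy.Γ f
  triangle : ∀ (f g : toPEnergy.domain) (A : Set X), MeasurableSet A →
    (toPEnergy.Γ (f + g) A) ^ (1 / p) ≤
      (toPEnergy.Γ f A) ^ (1 / p) + (toPEnergy.Γ g A) ^ (1 / p)
  /-- Lipschitz contractivity, for every Lipschitz constant `K` of `g`, so in particular for the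
  smallest one. -/
  contractivity : ∀ (f : toPEnergy.domain) (g : ℝ → ℝ) (K : ℝ≥0) (hg : LipschitzWith K g)
    (h0 : g 0 = 0),
    ∃ hmem : hg.compLp h0 (f : Lp ℝ (ENNReal.ofReal p) μ) ∈ toPEnergy.domain,
      toPEnergy.Γ ⟨hg.compLp h0 (f : Lp ℝ (ENNReal.ofReal p) μ), hmem⟩ ≤
        ((K : ℝ≥0∞) ^ p) • toPEnergy.Γ f
  strongLocality : ∀ (f : toPEnergy.domain) (A : Set X) (c : ℝ), IsOpen A →
    (∀ᵐ x ∂μ, x ∈ A → (f : Lp ℝ (ENNReal.ofReal p) μ) x = c) → toPEnergy.Γ f A = 0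
  lowerSemicontinuity : ∀ (f : Lp ℝ (ENNReal.ofReal p) μ) (u : ℕ → toPEnergy.domain),
    Tendsto (fun n => ‖(u n : Lp ℝ (ENNReal.ofReal p) μ) - f‖) atTop (𝓝 0) →
    (∃ M : ℝ, ∀ n, toPEnergy.energy (u n) ≤ M) →
    ∃ hmem : f ∈ toPEnergy.domain, ∀ A : Set X, MeasurableSet A →
      toPEnergy.Γ ⟨f, hmem⟩ A ≤ liminf (fun n => toPEnergy.Γ (u n) A) atTop
  /-- `C_c(X) ∩ domain` is dense in the domain. -/
  regularity_domain : ∀ (f : toPEnergy.domain) (ε : ℝ), 0 < ε →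
    ∃ (φ : X → ℝ) (g : toPEnergy.domain), Continuous φ ∧ HasCompactSupport φ ∧
      toPEnergy.IsRep g φ ∧ toPEnergy.domainNorm (f - g) < ε
  /-- `C_c(X) ∩ domain` is uniformly dense in `C_c(X)`. -/
  regularity_cc : ∀ (ψ : X → ℝ) (ε : ℝ), Continuous ψ → HasCompactSupport ψ → 0 < ε →
    ∃ (φ : X → ℝ) (g : toPEnergy.domain), Continuous φ ∧ HasCompactSupport φ ∧
      toPEnergy.IsRep g φ ∧ ∀ x, |ψ x - φ x| < ε

/-- The radii `r` of the balls considered in `X`: `0 < r ≤ 2 diam(X)`, where `diam(X)` may be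
infinite. -/
def AdmissibleRadius (X : Type*) [MetricSpace X] (r : ℝ) : Prop :=
  0 < r ∧ ENNReal.ofReal r ≤ 2 * Metric.ediam (univ : Set X)

/-- `μ` is `C`-doubling. -/
def IsDoublingWith {X : Type*} [MetricSpace X] [MeasurableSpace X]
    (μ : Measure X) (C : ℝ) : Prop :=
  ∀ (x : X) (r : ℝ), 0 < r →
    μ (Metric.ball x (2 * r)) ≤ ENNReal.ofReal C * μ (Metric.ball x r)

/-- `Ψ` is a regular scale function with constant `C` and exponents `βm`, `βp`
(the lower and the upper exponent). -/
structure IsRegularScale {X : Type*} [MetricSpace X]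
    (Ψ : X → ℝ → ℝ) (C βm βp : ℝ) : Prop where
  zero : ∀ x, Ψ x 0 = 0
  pos : ∀ x r, 0 < r → 0 < Ψ x r
  lower : ∀ (x y : X) (s r : ℝ), 0 < s → s ≤ r → AdmissibleRadius X r →
    C⁻¹ * (r / max r (dist x y)) ^ βp * (max r (dist x y) / s) ^ βm ≤ Ψ x r / Ψ y s
  upper : ∀ (x y : X) (s r : ℝ), 0 < s → s ≤ r → AdmissibleRadius X r →
    Ψ x r / Ψ y s ≤ C * (r / max r (dist x y)) ^ βm * (max r (dist x y) / s) ^ βp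

namespace PEnergy

variable {X : Type*} [MetricSpace X] [MeasurableSpace X] [BorelSpace X]
  {μ : Measure X} {p : ℝ}

/-- The upper capacity bound with scale function `Ψ` and constant `C`. -/
def CapUpperBound (D : PEnergy μ p) (Ψ : X → ℝ → ℝ) (C : ℝ) : Prop :=
  ∀ (x : X) (r : ℝ), AdmissibleRadius X r →
    ∃ (ψ : D.domain) (φ : X → ℝ), Continuous φ ∧ D.IsRep ψ φ ∧
      (∀ y ∈ Metric.ball x r, φ y = 1) ∧
      (∀ y ∉ Metric.ball x (2 * r), φ y = 0) ∧
      D.Γ ψ univ = D.Γ ψ (Metric.ball x (2 * r)) ∧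
      D.Γ ψ univ ≤ ENNReal.ofReal C * (μ (Metric.ball x r) / ENNReal.ofReal (Ψ x r))

/-- The Poincaré inequality with scale function `Ψ`, constant `C` and dilation `Λ`. -/
def PoincareInequality (D : PEnergy μ p) (Ψ : X → ℝ → ℝ) (C Λ : ℝ) : Prop :=
  ∀ (x : X) (r : ℝ), AdmissibleRadius X r → ∀ f : D.domain,
    ⨍⁻ y in Metric.ball x r,
        ‖(f : Lp ℝ (ENNReal.ofReal p) μ) y -
          ⨍ z in Metric.ball x r, (f : Lp ℝ (ENNReal.ofReal p) μ) z ∂μ‖ₑ ^ p ∂μ ≤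
      ENNReal.ofReal C * (ENNReal.ofReal (Ψ x r) / μ (Metric.ball x r)) *
        D.Γ f (Metric.ball x (Λ * r))

end PEnergy

end

/-! Put `u = f - g`. It suffices to find `v` in the domain that equals `u` on `B₀`, vanishes outside
`(1 + η)B₀`, and has total energy bounded by the energy of `u` on `(1 + η)B₀` plus `Ψ(B₀)⁻¹ ∫ |u|^p`
over the same ball (`exists_cutoff_extension`); then `h = g + v` works (`exists_blending`).

The axioms contain no product rule, so `u` cannot simply be multiplied by a cutoff. Instead `u` is
replaced by a discrete convolution `v_m = ∑ c_i φ_i`, where `c_i` is the mean of `u` on a ball `B_i`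
and the `φ_i` come from a partition of unity. The balls form a Whitney cover: with `δ = d(·, x₀) -
R`, their radii are comparable to `δ` in the annulus and are frozen at level `m` once `δ < a / 2 ^
m`, inside `B₀` included. The `φ_i` are differences of clamped partial sums of the capacity cutoffs,
which needs only Lipschitz contraction and the triangle inequality. They telescope to one wherever
some cutoff is one, and by locality their energy is at most a constant times `μ(B_i) / Ψ(B_i)`.

Energy bound, uniform in `m`: near a ball of level at least one the `φ_j` sum to one, so locality
allows a constant to be subtracted from all the `c_j`, and the Poincaré inequality controls the
remaining oscillation. Balls of level zero lie near the outer edge, where the sum drops below one;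
their radius is comparable to `R`, and Jensen's inequality with `Ψ(B₀)` gives the `L^p` term.
Bounded overlap sums the local bounds (`gamma_blend_ball_le`, `gamma_blend_whitney_le`).

Convergence: `v_m` is `L^p`-close to `u` near `B₀`, because the Poincaré bound carries the factor
`Ψ` of a small ball, which decays through the exponent `βm` (`lintegral_blend_sub_le`). Away from
`B₀` the sequence is eventually constant, because covers of different depths share their lower
levels (`sum_truncPart_eq_of_le`). Hence `v_m` is Cauchy in `L^p`, and lower semicontinuity passes
the energy bound to the limit `v`. -/

noncomputable section

/-! ### Representatives and the clamping operation -/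

/-- The projection of the real line onto `[0, 1]`. -/
def unitClamp (t : ℝ) : ℝ := max 0 (min t 1)

lemma unitClamp_zero : unitClamp 0 = 0 := by simp [unitClamp]

lemma unitClamp_one : unitClamp 1 = 1 := by simp [unitClamp]

lemma unitClamp_nonneg (t : ℝ) : 0 ≤ unitClamp t := le_max_left _ _

lemma unitClamp_le_one (t : ℝ) : unitClamp t ≤ 1 := max_le zero_le_one (min_le_right _ _)

lemma unitClamp_of_one_le {t : ℝ} (h : 1 ≤ t) : unitClamp t = 1 := by
  simp [unitClamp, h]

lemma unitClamp_mono {s t : ℝ} (h : s ≤ t) : unitClamp s ≤ unitClamp t :=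
  max_le_max le_rfl (min_le_min h le_rfl)

lemma lipschitzWith_unitClamp : LipschitzWith 1 unitClamp :=
  (LipschitzWith.id.min_const 1).const_max 0

namespace PEnergy

variable {X : Type*} [MetricSpace X] [MeasurableSpace X] [BorelSpace X]
  {μ : Measure X} {p : ℝ} {D : PEnergy μ p}

lemma isRep_zero : D.IsRep 0 (fun _ => 0) := by
  have := Lp.coeFn_zero ℝ (ENNReal.ofReal p) μ
  filter_upwards [this] with x hx
  simpa using hx

lemma IsRep.add {f g : D.domain} {φ χ : X → ℝ} (hf : D.IsRep f φ) (hg : D.IsRep g χ) :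
    D.IsRep (f + g) (fun x => φ x + χ x) := by
  filter_upwards [hf, hg, Lp.coeFn_add (f : Lp ℝ (ENNReal.ofReal p) μ) g] with x h1 h2 h3
  simpa [h1, h2] using h3

lemma IsRep.sub {f g : D.domain} {φ χ : X → ℝ} (hf : D.IsRep f φ) (hg : D.IsRep g χ) :
    D.IsRep (f - g) (fun x => φ x - χ x) := by
  filter_upwards [hf, hg, Lp.coeFn_sub (f : Lp ℝ (ENNReal.ofReal p) μ) g] with x h1 h2 h3
  simpa [h1, h2] using h3

lemma IsRep.smul {f : D.domain} {φ : X → ℝ} (hf : D.IsRep f φ) (c : ℝ) :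
    D.IsRep (c • f) (fun x => c * φ x) := by
  filter_upwards [hf, Lp.coeFn_smul c (f : Lp ℝ (ENNReal.ofReal p) μ)] with x h1 h2
  simpa [h1] using h2

lemma IsRep.sum {ι : Type*} (s : Finset ι) {f : ι → D.domain} {φ : ι → X → ℝ}
    (h : ∀ i ∈ s, D.IsRep (f i) (φ i)) :
    D.IsRep (∑ i ∈ s, f i) (fun x => ∑ i ∈ s, φ i x) := by
  classical
  induction s using Finset.induction_on with
  | empty => simpa using isRep_zero
  | insert a s ha ih =>
    have h2 := (h a (Finset.mem_insert_self a s)).add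
      (ih fun i hi => h i (Finset.mem_insert_of_mem hi))
    simpa [Finset.sum_insert ha] using h2

end PEnergy

namespace PDirichletSpace

variable {X : Type*} [MetricSpace X] [MeasurableSpace X] [BorelSpace X]
  {μ : Measure X} {p : ℝ} (D : PDirichletSpace μ p)

/-- The element of the domain obtained by clamping `f` to `[0, 1]`. -/
def clamp (f : D.domain) : D.domain :=
  ⟨_, (D.contractivity f unitClamp 1 lipschitzWith_unitClamp unitClamp_zero).choose⟩

variable {D}

lemma isRep_clamp {f : D.domain} {φ : X → ℝ} (hf : D.IsRep f φ) :
    D.IsRep (D.clamp f) (fun x => unitClamp (φ x)) := by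
  have h := lipschitzWith_unitClamp.coeFn_compLp unitClamp_zero
    (f : Lp ℝ (ENNReal.ofReal p) μ)
  filter_upwards [hf, h] with x h1 h2
  simpa [clamp, h1] using h2

lemma gamma_clamp_le (f : D.domain) (A : Set X) : D.Γ (D.clamp f) A ≤ D.Γ f A := by
  have h := (D.contractivity f unitClamp 1 lipschitzWith_unitClamp unitClamp_zero).choose_spec
  simpa [clamp] using Measure.le_iff'.1 h A

lemma gamma_smul (c : ℝ) (f : D.domain) (A : Set X) :
    D.Γ (c • f) A = ENNReal.ofReal (|c| ^ p) * D.Γ f A := by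
  rw [D.homogeneity]; simp

lemma gamma_neg (f : D.domain) (A : Set X) : D.Γ (-f) A = D.Γ f A := by
  have := gamma_smul (-1) f A
  simpa only [neg_smul, one_smul, abs_neg, abs_one, Real.one_rpow, ENNReal.ofReal_one,
    one_mul] using this

lemma gamma_zero (hp : 0 < p) (A : Set X) : D.Γ 0 A = 0 := by
  have := gamma_smul (D := D) 0 0 A
  simpa [Real.zero_rpow hp.ne'] using this

lemma gamma_rpow_sum_le (hp : 0 < p) {ι : Type*} (s : Finset ι) (f : ι → D.domain)
    {A : Set X} (hA : MeasurableSet A) :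
    D.Γ (∑ i ∈ s, f i) A ^ (1 / p) ≤ ∑ i ∈ s, D.Γ (f i) A ^ (1 / p) := by
  classical
  induction s using Finset.induction_on with
  | empty => simp [gamma_zero hp, hp]
  | insert a s ha ih =>
    rw [Finset.sum_insert ha, Finset.sum_insert ha]
    exact (D.triangle _ _ A hA).trans (add_le_add le_rfl ih)

/-- Subadditivity of `Γ^{1/p}` followed by the power mean inequality; the factor depends on the
number of terms, so useful bounds first localize the sum. -/
lemma gamma_sum_le (hp : 1 ≤ p) {ι : Type*} (s : Finset ι) (f : ι → D.domain)
    {A : Set X} (hA : MeasurableSet A) :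
    D.Γ (∑ i ∈ s, f i) A ≤ (s.card : ℝ≥0∞) ^ (p - 1) * ∑ i ∈ s, D.Γ (f i) A := by
  have hp0 : 0 < p := by linarith
  have h1 := ENNReal.rpow_le_rpow (gamma_rpow_sum_le hp0 s f hA) hp0.le
  have h2 := ENNReal.rpow_sum_le_const_mul_sum_rpow s (fun i => D.Γ (f i) A ^ (1 / p)) hp
  simp only [← ENNReal.rpow_mul, one_div, inv_mul_cancel₀ hp0.ne', ENNReal.rpow_one] at h1 h2
  exact h1.trans h2

lemma gamma_sub_le (hp : 1 ≤ p) (f g : D.domain) {A : Set X} (hA : MeasurableSet A) :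
    D.Γ (f - g) A ≤ 2 ^ (p - 1) * (D.Γ f A + D.Γ g A) := by
  have h := gamma_sum_le hp Finset.univ ![f, -g] hA
  simpa [Fin.sum_univ_two, gamma_neg, ← sub_eq_add_neg] using h

lemma gamma_add_le (hp : 1 ≤ p) (f g : D.domain) {A : Set X} (hA : MeasurableSet A) :
    D.Γ (f + g) A ≤ 2 ^ (p - 1) * (D.Γ f A + D.Γ g A) := by
  have h := gamma_sum_le hp Finset.univ ![f, g] hA
  simpa [Fin.sum_univ_two] using h

lemma gamma_eq_zero_of_const {f : D.domain} {φ : X → ℝ} (hf : D.IsRep f φ) {A : Set X}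
    (hA : IsOpen A) {c : ℝ} (h : ∀ x ∈ A, φ x = c) : D.Γ f A = 0 := by
  refine D.strongLocality f A c hA ?_
  filter_upwards [hf] with x hx hxA
  rw [hx, h x hxA]

/-- Elements of the domain that differ by a constant on an open set have the same energy there. -/
lemma gamma_le_of_sub_const (hp : 0 < p) {f g : D.domain} {φ χ : X → ℝ} (hf : D.IsRep f φ)
    (hg : D.IsRep g χ) {A : Set X} (hA : IsOpen A) {c : ℝ} (h : ∀ x ∈ A, φ x - χ x = c) :
    D.Γ f A ≤ D.Γ g A := by
  have h0 : D.Γ (f - g) A = 0 := gamma_eq_zero_of_const (hf.sub hg) hA h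
  -- Write `f = g + (f - g)`: locality kills the energy of the second summand on `A`.
  have h1 := D.triangle g (f - g) A hA.measurableSet
  rw [h0, add_sub_cancel, ENNReal.zero_rpow_of_pos (by positivity), add_zero] at h1
  exact (ENNReal.rpow_le_rpow_iff (by positivity)).1 h1

end PDirichletSpace

/-! ### Partitions of unity by truncation -/

section Partition

variable {X ι : Type*} [LinearOrder ι]

/-- The `i`-th function of the partition of unity obtained from the functions `ψ j`, `j ∈ I`, by
truncating their partial sums at height one. -/
def truncPart (ψ : ι → X → ℝ) (I : Finset ι) (i : ι) (x : X) : ℝ :=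
  unitClamp (∑ j ∈ I with j ≤ i, ψ j x) - unitClamp (∑ j ∈ I with j < i, ψ j x)

variable {ψ : ι → X → ℝ} {I : Finset ι} {i : ι} {x : X}

lemma sum_filter_le_eq (hi : i ∈ I) (a : ι → ℝ) :
    ∑ j ∈ I with j ≤ i, a j = a i + ∑ j ∈ I with j < i, a j := by
  have : I.filter (· ≤ i) = insert i (I.filter (· < i)) := by
    ext j
    simp only [Finset.mem_filter, Finset.mem_insert, le_iff_eq_or_lt]
    constructor
    · rintro ⟨h, rfl | h2⟩ <;> simp_all
    · rintro (rfl | h) <;> simp_all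
  rw [this, Finset.sum_insert (by simp)]

lemma truncPart_nonneg (hψ : ∀ j x, 0 ≤ ψ j x) : 0 ≤ truncPart ψ I i x := by
  refine sub_nonneg.2 (unitClamp_mono (Finset.sum_le_sum_of_subset_of_nonneg ?_ ?_))
  · intro j; simp +contextual [le_of_lt]
  · intros; exact hψ _ _

lemma truncPart_le_one : truncPart ψ I i x ≤ 1 := by
  have h1 := unitClamp_le_one (∑ j ∈ I with j ≤ i, ψ j x)
  have h2 := unitClamp_nonneg (∑ j ∈ I with j < i, ψ j x)
  rw [truncPart]; linarith

/-- The two partial sums coincide when `ψ i x = 0`. Thus each part inherits the support of its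
cutoff, whatever the order on the index set. -/
lemma truncPart_eq_zero (hi : i ∈ I) (h : ψ i x = 0) : truncPart ψ I i x = 0 := by
  rw [truncPart, sum_filter_le_eq hi, h, zero_add, sub_self]

/-- A telescoping sum. The induction adds the largest index because this leaves all earlier parts
unchanged. -/
lemma sum_truncPart (ψ : ι → X → ℝ) (I : Finset ι) (x : X) :
    ∑ i ∈ I, truncPart ψ I i x = unitClamp (∑ i ∈ I, ψ i x) := by
  induction I using Finset.induction_on_max with
  | empty => simp [unitClamp_zero]
  | insert a s hs ih =>
    have ha : a ∉ s := fun h => lt_irrefl _ (hs a h)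
    rw [Finset.sum_insert ha]
    have h1 : ∀ i ∈ s, truncPart ψ (insert a s) i x = truncPart ψ s i x := by
      intro i hi
      have := hs i hi
      simp only [truncPart, Finset.filter_insert, not_le.2 this, not_lt.2 this.le, if_false]
    have h2 : (insert a s).filter (· ≤ a) = insert a s := by
      rw [Finset.filter_true_of_mem]
      intro j hj
      rcases Finset.mem_insert.1 hj with rfl | hj
      exacts [le_rfl, (hs j hj).le]
    have h3 : (insert a s).filter (· < a) = s := by
      rw [Finset.filter_insert, if_neg (lt_irrefl a), Finset.filter_true_of_mem hs]
    rw [Finset.sum_congr rfl h1, ih, truncPart, h2, h3]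
    ring

lemma sum_truncPart_eq_one (hψ : ∀ j x, 0 ≤ ψ j x) (hi : i ∈ I) (h : ψ i x = 1) :
    ∑ j ∈ I, truncPart ψ I j x = 1 := by
  rw [sum_truncPart]
  exact unitClamp_of_one_le (h ▸ Finset.single_le_sum (f := fun j => ψ j x)
    (fun j _ => hψ j x) hi)

lemma sum_filter_congr_of_support {ι : Type*} {I J : Finset ι} {a : ι → ℝ}
    (h : ∀ j, a j ≠ 0 → (j ∈ I ↔ j ∈ J)) (P : ι → Prop) [DecidablePred P] (b : ι → ℝ)
    (hb : ∀ j, a j = 0 → b j = 0) :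
    ∑ j ∈ I with P j, b j = ∑ j ∈ J with P j, b j := by
  classical
  rw [← Finset.sum_filter_ne_zero (I.filter P), ← Finset.sum_filter_ne_zero (J.filter P)]
  refine Finset.sum_congr ?_ fun _ _ => rfl
  ext j
  simp only [Finset.mem_filter]
  by_cases hj : b j = 0
  · simp [hj]
  · rw [h j fun h0 => hj (hb j h0)]

/-- The value at `x` of a sum over the partition of unity depends only on the functions that do
not vanish at `x`. -/
lemma sum_truncPart_congr {I J : Finset ι} (h : ∀ j, ψ j x ≠ 0 → (j ∈ I ↔ j ∈ J)) (c : ι → ℝ) :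
    ∑ i ∈ I, c i * truncPart ψ I i x = ∑ i ∈ J, c i * truncPart ψ J i x := by
  have key : ∀ i, truncPart ψ I i x = truncPart ψ J i x := fun i => by
    rw [truncPart, truncPart,
      sum_filter_congr_of_support h (· ≤ i) (fun j => ψ j x) (fun _ h => h),
      sum_filter_congr_of_support h (· < i) (fun j => ψ j x) (fun _ h => h)]
  classical
  rw [← Finset.sum_filter_ne_zero I, ← Finset.sum_filter_ne_zero J]
  refine Finset.sum_congr ?_ fun i _ => by rw [key]
  ext i
  simp only [Finset.mem_filter, key]
  by_cases hi : ψ i x = 0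
  · constructor
    · rintro ⟨h1, h2⟩
      rw [← key, truncPart_eq_zero h1 hi] at h2
      simp at h2
    · rintro ⟨h1, h2⟩
      rw [truncPart_eq_zero h1 hi] at h2
      simp at h2
  · rw [h i hi]

end Partition

namespace PDirichletSpace

variable {X : Type*} [MetricSpace X] [MeasurableSpace X] [BorelSpace X]
  {μ : Measure X} {p : ℝ} {D : PDirichletSpace μ p} {ι : Type*}
  {f : ι → D.domain} {ψ : ι → X → ℝ} {I : Finset ι} {i : ι}

lemma gamma_smul_enorm (hp : 0 ≤ p) (c : ℝ) (f : D.domain) (A : Set X) :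
    D.Γ (c • f) A = ‖c‖ₑ ^ p * D.Γ f A := by
  rw [gamma_smul, Real.enorm_eq_ofReal_abs, ENNReal.ofReal_rpow_of_nonneg (abs_nonneg c) hp]

-- By locality, terms vanishing on `U` can be dropped before the triangle inequality is applied, so
-- the constant involves the local count `N` and not the size of `T`.
open Classical in
lemma gamma_sum_le_of_local (hp : 1 ≤ p) (hf : ∀ i ∈ I, D.IsRep (f i) (ψ i)) {T : Finset ι}
    (hT : T ⊆ I) {U : Set X} (hU : IsOpen U) {N : ℕ} {e : ℝ≥0∞}
    (hN : (I.filter fun j => ∃ x ∈ U, ψ j x ≠ 0).card ≤ N)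
    (he : ∀ j ∈ I, (∃ x ∈ U, ψ j x ≠ 0) → D.Γ (f j) univ ≤ e) :
    D.Γ (∑ j ∈ T, f j) U ≤ (N : ℝ≥0∞) ^ (p - 1) * (N * e) := by
  set S := T.filter fun j => ∃ x ∈ U, ψ j x ≠ 0 with hS
  have hSN : S.card ≤ N := (Finset.card_le_card (Finset.filter_subset_filter _ hT)).trans hN
  have h1 : D.Γ (∑ j ∈ T, f j) U ≤ D.Γ (∑ j ∈ S, f j) U := by
    refine gamma_le_of_sub_const (c := 0) (by linarith)
      (PEnergy.IsRep.sum T fun j hj => hf j (hT hj))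
      (PEnergy.IsRep.sum S fun j hj => hf j (hT (Finset.mem_filter.1 hj).1)) hU ?_
    intro x hx
    rw [sub_eq_zero, hS, Finset.sum_filter_of_ne]
    exact fun j _ hj => ⟨x, hx, hj⟩
  refine h1.trans ((gamma_sum_le hp S f hU.measurableSet).trans ?_)
  have h2 : ∑ j ∈ S, D.Γ (f j) U ≤ S.card * e := by
    rw [← nsmul_eq_mul]
    refine Finset.sum_le_card_nsmul _ _ _ fun j hj => ?_
    obtain ⟨h3, h4⟩ := Finset.mem_filter.1 hj
    exact (measure_mono (subset_univ _)).trans (he j (hT h3) h4)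
  have h3 : (S.card : ℝ≥0∞) ≤ N := by exact_mod_cast hSN
  gcongr
  exact h2.trans (by gcongr)

variable [LinearOrder ι]

variable (D) in
/-- The element of the domain represented by `truncPart`. -/
def partElem (f : ι → D.domain) (I : Finset ι) (i : ι) : D.domain :=
  D.clamp (∑ j ∈ I with j ≤ i, f j) - D.clamp (∑ j ∈ I with j < i, f j)

variable (D) in
/-- The combination with coefficients `c` of the truncated partition of unity. -/
def blend (f : ι → D.domain) (I : Finset ι) (c : ι → ℝ) : D.domain :=
  ∑ i ∈ I, c i • D.partElem f I i

lemma isRep_partElem (hf : ∀ i ∈ I, D.IsRep (f i) (ψ i)) (i : ι) :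
    D.IsRep (D.partElem f I i) (truncPart ψ I i) :=
  (isRep_clamp (PEnergy.IsRep.sum _ fun j hj => hf j (Finset.mem_filter.1 hj).1)).sub
    (isRep_clamp (PEnergy.IsRep.sum _ fun j hj => hf j (Finset.mem_filter.1 hj).1))

lemma isRep_blend (hf : ∀ i ∈ I, D.IsRep (f i) (ψ i)) (c : ι → ℝ) :
    D.IsRep (D.blend f I c) (fun x => ∑ i ∈ I, c i * truncPart ψ I i x) :=
  PEnergy.IsRep.sum _ fun i _ => (isRep_partElem hf i).smul (c i)

-- The part vanishes off `K`, so all its energy sits in `U`. There it is a difference of two clamped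
-- partial sums, and each of these sees only the cutoffs that meet `U`.
open Classical in
lemma gamma_partElem_le (hp : 1 ≤ p) (hf : ∀ i ∈ I, D.IsRep (f i) (ψ i)) (hi : i ∈ I)
    {K U : Set X} (hK : IsClosed K) (hU : IsOpen U) (hKU : K ⊆ U)
    (hψ : ∀ x ∉ K, ψ i x = 0) {N : ℕ} {e : ℝ≥0∞}
    (hN : (I.filter fun j => ∃ x ∈ U, ψ j x ≠ 0).card ≤ N)
    (he : ∀ j ∈ I, (∃ x ∈ U, ψ j x ≠ 0) → D.Γ (f j) univ ≤ e) :
    D.Γ (D.partElem f I i) univ ≤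
      2 ^ (p - 1) * (2 * ((N : ℝ≥0∞) ^ (p - 1) * (N * e))) := by
  have h0 : D.Γ (D.partElem f I i) Kᶜ = 0 :=
    gamma_eq_zero_of_const (c := 0) (isRep_partElem hf i) hK.isOpen_compl
      fun x hx => truncPart_eq_zero hi (hψ x hx)
  have h1 : D.Γ (D.partElem f I i) univ ≤ D.Γ (D.partElem f I i) U := by
    have : (univ : Set X) ⊆ U ∪ Kᶜ := fun x _ => by
      by_cases hx : x ∈ K
      exacts [Or.inl (hKU hx), Or.inr hx]
    refine (measure_mono this).trans ((measure_union_le _ _).trans ?_)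
    rw [h0, add_zero]
  refine h1.trans ((gamma_sub_le hp _ _ hU.measurableSet).trans ?_)
  rw [two_mul]
  gcongr
  · exact (gamma_clamp_le _ _).trans
      (gamma_sum_le_of_local hp hf (Finset.filter_subset _ _) hU hN he)
  · exact (gamma_clamp_le _ _).trans
      (gamma_sum_le_of_local hp hf (Finset.filter_subset _ _) hU hN he)

open Classical in
/-- On an open set, the energy of a blend is controlled by the oscillation of the nearby
coefficients about a constant `a`, if the partition sums to one there or if `a = 0`. -/
lemma gamma_blend_le (hp : 1 ≤ p) (hf : ∀ i ∈ I, D.IsRep (f i) (ψ i)) (c : ι → ℝ)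
    {U : Set X} (hU : IsOpen U) {N : ℕ}
    (hN : (I.filter fun j => ∃ x ∈ U, ψ j x ≠ 0).card ≤ N) {a : ℝ}
    (ha : a = 0 ∨ ∀ x ∈ U, ∑ j ∈ I, truncPart ψ I j x = 1) {e : ℝ≥0∞}
    (he : ∀ j ∈ I, (∃ x ∈ U, ψ j x ≠ 0) →
      ‖c j - a‖ₑ ^ p * D.Γ (D.partElem f I j) univ ≤ e) :
    D.Γ (D.blend f I c) U ≤ (N : ℝ≥0∞) ^ (p - 1) * (N * e) := by
  set S := I.filter fun j => ∃ x ∈ U, ψ j x ≠ 0 with hS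
  -- On `U` the two functions differ by `a` times the sum of the parts, which is the constant `a`
  -- under either alternative of `ha`.
  have h1 : D.Γ (D.blend f I c) U ≤ D.Γ (∑ j ∈ S, (c j - a) • D.partElem f I j) U := by
    refine gamma_le_of_sub_const (c := a) (by linarith) (isRep_blend hf c)
      (PEnergy.IsRep.sum S fun j _ => (isRep_partElem hf j).smul (c j - a)) hU ?_
    intro x hx
    have h2 : ∑ j ∈ S, (c j - a) * truncPart ψ I j x
        = ∑ j ∈ I, (c j - a) * truncPart ψ I j x := by
      rw [hS, Finset.sum_filter_of_ne]
      intro j hj hne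
      refine ⟨x, hx, fun h => hne ?_⟩
      rw [truncPart_eq_zero hj h, mul_zero]
    rw [h2, ← Finset.sum_sub_distrib]
    simp only [sub_mul, sub_sub_cancel]
    rw [← Finset.mul_sum]
    rcases ha with rfl | ha
    · simp
    · rw [ha x hx, mul_one]
  refine h1.trans ((gamma_sum_le hp S _ hU.measurableSet).trans ?_)
  have h2 : ∑ j ∈ S, D.Γ ((c j - a) • D.partElem f I j) U ≤ S.card * e := by
    rw [← nsmul_eq_mul]
    refine Finset.sum_le_card_nsmul _ _ _ fun j hj => ?_
    obtain ⟨h3, h4⟩ := Finset.mem_filter.1 hj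
    rw [gamma_smul_enorm (by linarith)]
    refine le_trans ?_ (he j h3 h4)
    gcongr
    exact subset_univ _
  have h3 : (S.card : ℝ≥0∞) ≤ N := by exact_mod_cast hN
  gcongr
  exact h2.trans (by gcongr)

/-- Outside the closed union of the `K i` the blend vanishes on an open set and carries no energy;
the `U i` cover the rest. -/
lemma gamma_blend_univ_le (hf : ∀ i ∈ I, D.IsRep (f i) (ψ i)) (c : ι → ℝ)
    {K U : ι → Set X} (hK : ∀ i ∈ I, IsClosed (K i)) (hKU : ∀ i ∈ I, K i ⊆ U i)
    (hψ : ∀ i ∈ I, ∀ x ∉ K i, ψ i x = 0) :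
    D.Γ (D.blend f I c) univ ≤ ∑ i ∈ I, D.Γ (D.blend f I c) (U i) := by
  have hcl : IsClosed (⋃ i ∈ I, K i) := I.finite_toSet.isClosed_biUnion hK
  have h0 : D.Γ (D.blend f I c) (⋃ i ∈ I, K i)ᶜ = 0 := by
    refine gamma_eq_zero_of_const (c := 0) (isRep_blend hf c) hcl.isOpen_compl fun x hx => ?_
    refine Finset.sum_eq_zero fun i hi => ?_
    rw [truncPart_eq_zero hi (hψ i hi x fun h => hx (mem_biUnion hi h)), mul_zero]
  have h1 : (univ : Set X) ⊆ (⋃ i ∈ I, U i) ∪ (⋃ i ∈ I, K i)ᶜ := fun x _ => by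
    by_cases hx : x ∈ ⋃ i ∈ I, K i
    · exact Or.inl (biUnion_mono (fun _ h => h) hKU hx)
    · exact Or.inr hx
  refine (measure_mono h1).trans ((measure_union_le _ _).trans ?_)
  rw [h0, add_zero]
  exact measure_biUnion_finset_le _ _

end PDirichletSpace

/-! ### Measure theoretic lemmas -/

section Measure

variable {X : Type*} [MeasurableSpace X]

open Classical in
/-- A family of sets with bounded overlap has bounded total measure. -/
lemma sum_measure_le_of_overlap {ι : Type*} (ν : Measure X) (I : Finset ι) {A : ι → Set X}
    {Ω : Set X} (hA : ∀ i ∈ I, MeasurableSet (A i)) (hΩ : MeasurableSet Ω)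
    (hsub : ∀ i ∈ I, A i ⊆ Ω) {N : ℕ} (hN : ∀ x, (I.filter fun i => x ∈ A i).card ≤ N) :
    ∑ i ∈ I, ν (A i) ≤ N * ν Ω := by
  have h1 : ∑ i ∈ I, ν (A i) = ∫⁻ x, ∑ i ∈ I, (A i).indicator 1 x ∂ν := by
    rw [lintegral_finsetSum' _ fun i hi => (measurable_one.indicator (hA i hi)).aemeasurable]
    exact Finset.sum_congr rfl fun i hi => (lintegral_indicator_one (hA i hi)).symm
  rw [h1, ← lintegral_indicator_const hΩ]
  refine lintegral_mono fun x => ?_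
  by_cases hx : x ∈ Ω
  · have h2 : ∑ i ∈ I, (A i).indicator (1 : X → ℝ≥0∞) x
        = ((I.filter fun i => x ∈ A i).card : ℝ≥0∞) := by
      simp [Set.indicator_apply, Finset.sum_boole]
    simp only [indicator_of_mem hx, h2]
    exact_mod_cast hN x
  · rw [Finset.sum_eq_zero]
    · simp
    · exact fun i hi => indicator_of_notMem (fun h => hx (hsub i hi h)) _

/-- Jensen's inequality for the power `t ↦ t ^ p`. -/
lemma enorm_setAverage_sub_rpow_le {μ : Measure X} {p : ℝ} (hp : 1 ≤ p) {u : X → ℝ} {B : Set X}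
    (h0 : μ B ≠ 0) (ht : μ B ≠ ∞) (hu : IntegrableOn u B μ) (a : ℝ) :
    ‖(⨍ z in B, u z ∂μ) - a‖ₑ ^ p ≤ (μ B)⁻¹ * ∫⁻ z in B, ‖u z - a‖ₑ ^ p ∂μ := by
  have : IsFiniteMeasure (μ.restrict B) := ⟨by simpa using ht.lt_top⟩
  have : NeZero (μ.restrict B) := ⟨by simpa using h0⟩
  set ν := ((μ.restrict B) univ)⁻¹ • μ.restrict B with hν
  have hprob : IsProbabilityMeasure ν := inferInstance
  have hint : Integrable u ν := hu.to_average
  have h1 : (⨍ z in B, u z ∂μ) - a = ∫ z, (u z - a) ∂ν := by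
    rw [integral_sub hint (integrable_const a), integral_const, average, probReal_univ, one_smul]
  have hm : AEStronglyMeasurable (fun z => u z - a) ν :=
    hint.aestronglyMeasurable.sub aestronglyMeasurable_const
  have h2 : ∫⁻ z, ‖u z - a‖ₑ ∂ν ≤ (∫⁻ z, ‖u z - a‖ₑ ^ p ∂ν) ^ (1 / p) := by
    have h := eLpNorm'_le_eLpNorm'_of_exponent_le one_pos hp ν hm
    simpa [eLpNorm'] using h
  have h3 : (μ B)⁻¹ * ∫⁻ z in B, ‖u z - a‖ₑ ^ p ∂μ = ∫⁻ z, ‖u z - a‖ₑ ^ p ∂ν := by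
    rw [hν, lintegral_smul_measure]; simp
  rw [h1, h3]
  calc ‖∫ z, (u z - a) ∂ν‖ₑ ^ p ≤ (∫⁻ z, ‖u z - a‖ₑ ∂ν) ^ p := by
        gcongr; exact enorm_integral_le_lintegral_enorm _
    _ ≤ ((∫⁻ z, ‖u z - a‖ₑ ^ p ∂ν) ^ (1 / p)) ^ p := by gcongr
    _ = _ := by rw [← ENNReal.rpow_mul, one_div, inv_mul_cancel₀ (by linarith), ENNReal.rpow_one]

end Measure

/-! ### Doubling measures and separated sets -/

namespace IsDoublingWith

variable {X : Type*} [MetricSpace X] [MeasurableSpace X] {μ : Measure X} {C : ℝ}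

lemma measure_ball_pow_le (h : IsDoublingWith μ C) (x : X) {r : ℝ} (hr : 0 < r) (n : ℕ) :
    μ (Metric.ball x (2 ^ n * r)) ≤ ENNReal.ofReal C ^ n * μ (Metric.ball x r) := by
  induction n with
  | zero => simp
  | succ n ih =>
    have := h x (2 ^ n * r) (by positivity)
    rw [pow_succ', mul_assoc, pow_succ', mul_assoc]
    exact this.trans (by gcongr)

lemma measure_ball_le (h : IsDoublingWith μ C) {x y : X} {r s : ℝ} (hs : 0 < s) (n : ℕ)
    (hd : r + dist x y ≤ 2 ^ n * s) :
    μ (Metric.ball x r) ≤ ENNReal.ofReal C ^ n * μ (Metric.ball y s) :=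
  (measure_mono (Metric.ball_subset_ball' hd)).trans (h.measure_ball_pow_le y hs n)

/-- A null ball would, by doubling, force all its dilates to be null, and these exhaust the space.
-/
lemma measure_ball_ne_zero (h : IsDoublingWith μ C) (hμ : μ ≠ 0) (x : X) {r : ℝ} (hr : 0 < r) :
    μ (Metric.ball x r) ≠ 0 := by
  intro h0
  apply hμ
  rw [← Measure.measure_univ_eq_zero]
  have hsub : (univ : Set X) ⊆ ⋃ n : ℕ, Metric.ball x (2 ^ n * r) := by
    intro y _
    obtain ⟨n, hn⟩ := pow_unbounded_of_one_lt (dist y x / r) one_lt_two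
    exact mem_iUnion.2 ⟨n, by rwa [Metric.mem_ball, ← div_lt_iff₀ hr]⟩
  refine measure_mono_null hsub (measure_iUnion_null fun n => ?_)
  have := h.measure_ball_pow_le x hr n
  rwa [h0, mul_zero, nonpos_iff_eq_zero] at this

lemma measure_ball_ne_top [LocallyCompactSpace X] [IsFiniteMeasureOnCompacts μ]
    (h : IsDoublingWith μ C) (x : X) (r : ℝ) : μ (Metric.ball x r) ≠ ∞ := by
  obtain ⟨K, hK, hx⟩ := exists_compact_mem_nhds x
  obtain ⟨s, hs, hsK⟩ := Metric.mem_nhds_iff.1 hx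
  obtain ⟨n, hn⟩ := pow_unbounded_of_one_lt (r / s) one_lt_two
  have h1 := h.measure_ball_le (x := x) (y := x) (r := r) hs n
    (by rw [dist_self, add_zero]; exact ((div_lt_iff₀ hs).1 hn).le)
  refine ne_top_of_le_ne_top (ENNReal.mul_ne_top (by finiteness) ?_) h1
  exact ne_top_of_le_ne_top hK.measure_ne_top (measure_mono hsK)

variable [BorelSpace X]

/-- A separated subset of a ball has a bounded number of elements. -/
lemma card_le_of_separated (h : IsDoublingWith μ C) (h0 : ∀ x r, 0 < r → μ (Metric.ball x r) ≠ 0)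
    (ht : ∀ x r, μ (Metric.ball x r) ≠ ∞) {s ρ : ℝ} (hs : 0 < s) {n : ℕ}
    (hn : 4 * ρ + s ≤ 2 ^ n * s) {y : X} {T : Finset X} (hT : ∀ x ∈ T, dist x y < ρ)
    (hsep : ∀ x ∈ T, ∀ z ∈ T, x ≠ z → s ≤ dist x z) :
    (T.card : ℝ≥0∞) ≤ ENNReal.ofReal C ^ n := by
  rcases T.eq_empty_or_nonempty with rfl | ⟨x₁, hx₁⟩
  · simp
  have hρ : 0 < ρ := dist_nonneg.trans_lt (hT _ hx₁)
  -- This ball contains the disjoint balls `B(x, s / 2)` with `x ∈ T`, and it lies in each `B(x, 2 ^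
  -- n * (s / 2))` because `2ρ + s / 2 ≤ 2 ^ n * (s / 2)`. Comparing measures counts `T`.
  set B := Metric.ball y (ρ + s / 2) with hB
  have hB0 : μ B ≠ 0 := h0 _ _ (by positivity)
  have h1 : ∀ x ∈ T, μ B ≤ ENNReal.ofReal C ^ n * μ (Metric.ball x (s / 2)) := fun x hx => by
    refine h.measure_ball_le (by positivity) n ?_
    have := hT x hx
    rw [dist_comm] at this
    linarith
  have h2 : ∑ x ∈ T, μ (Metric.ball x (s / 2)) ≤ μ B := by
    rw [← measure_biUnion_finset _ fun _ _ => Metric.isOpen_ball.measurableSet]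
    · refine measure_mono (iUnion₂_subset fun x hx => Metric.ball_subset_ball' ?_)
      linarith [hT x hx]
    · intro x hx z hz hxz
      exact Metric.ball_disjoint_ball (by linarith [hsep x hx z hz hxz])
  have h3 : (T.card : ℝ≥0∞) * μ B ≤ ENNReal.ofReal C ^ n * μ B := by
    calc (T.card : ℝ≥0∞) * μ B = ∑ x ∈ T, μ B := by simp
      _ ≤ ∑ x ∈ T, ENNReal.ofReal C ^ n * μ (Metric.ball x (s / 2)) := Finset.sum_le_sum h1
      _ ≤ _ := by rw [← Finset.mul_sum]; gcongr
  exact (ENNReal.mul_le_mul_iff_left hB0 (ht _ _)).1 h3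

/-- Bounded sets have finite maximal separated subsets. -/
lemma exists_finset_net (h : IsDoublingWith μ C) (h0 : ∀ x r, 0 < r → μ (Metric.ball x r) ≠ 0)
    (ht : ∀ x r, μ (Metric.ball x r) ≠ ∞) {s : ℝ} (hs : 0 < s) {A : Set X}
    (hA : Bornology.IsBounded A) :
    ∃ T : Finset X, (∀ x ∈ T, x ∈ A) ∧ (∀ x ∈ T, ∀ z ∈ T, x ≠ z → s ≤ dist x z) ∧
      ∀ y ∈ A, ∃ x ∈ T, dist y x < s := by
  classical
  rcases A.eq_empty_or_nonempty with rfl | ⟨x₀, hx₀⟩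
  · exact ⟨∅, by simp⟩
  obtain ⟨ρ, hρ⟩ := hA.subset_ball x₀
  obtain ⟨n, hn⟩ := pow_unbounded_of_one_lt ((4 * ρ + s) / s) one_lt_two
  have hn' := ((div_lt_iff₀ hs).1 hn).le
  obtain ⟨N, hN⟩ := ENNReal.exists_nat_gt (r := ENNReal.ofReal C ^ n) (by finiteness)
  let P : ℕ → Prop := fun k => ∃ T : Finset X, (∀ x ∈ T, x ∈ A) ∧
    (∀ x ∈ T, ∀ z ∈ T, x ≠ z → s ≤ dist x z) ∧ T.card = k
  have hP : ∀ k, P k → k ≤ N := by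
    rintro k ⟨T, hTA, hsep, rfl⟩
    have := h.card_le_of_separated h0 ht hs hn' (y := x₀) (T := T) (fun x hx => hρ (hTA x hx)) hsep
    exact_mod_cast (this.trans hN.le)
  have hP0 : P 0 := ⟨∅, by simp⟩
  -- A separated set of largest cardinality is maximal: an uncovered point could be added to it.
  obtain ⟨T, hTA, hsep, hcard⟩ := Nat.findGreatest_spec (P := P) (Nat.zero_le N) hP0
  refine ⟨T, hTA, hsep, fun y hy => ?_⟩
  by_contra! hcon
  have hyT : y ∉ T := fun hyT => by
    have := hcon y hyT
    rw [dist_self] at this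
    linarith
  have : P (T.card + 1) := by
    refine ⟨insert y T, ?_, ?_, Finset.card_insert_of_notMem hyT⟩
    · intro x hx
      rcases Finset.mem_insert.1 hx with rfl | hx
      exacts [hy, hTA x hx]
    · intro x hx z hz hxz
      rcases Finset.mem_insert.1 hx with hx' | hx' <;> rcases Finset.mem_insert.1 hz with hz' | hz'
      · exact absurd (hx'.trans hz'.symm) hxz
      · exact hx' ▸ hcon z hz'
      · rw [dist_comm]; exact hz' ▸ hcon x hx'
      · exact hsep x hx' z hz' hxz
  have h2 := Nat.le_findGreatest (hP _ this) this
  omega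

end IsDoublingWith

/-! ### Covers adapted to a distance function -/

/-- A finite cover of `{δ < a}` by balls whose radii `ε * (a / 2 ^ k)`, `k ≤ m`, are comparable to
`δ + a / 2 ^ m`. The index `(k, x)` stands for the ball of centre `x` and level `k`. -/
structure IsWhitneyCover {X : Type*} [MetricSpace X] (δ : X → ℝ) (a ε : ℝ) (m : ℕ)
    (I : Finset (ℕ × X)) : Prop where
  level_le : ∀ i ∈ I, i.1 ≤ m
  gap_lt : ∀ i ∈ I, δ i.2 < a / 2 ^ i.1
  le_gap : ∀ i ∈ I, i.1 < m → a / 2 ^ i.1 / 2 ≤ δ i.2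
  separated : ∀ i ∈ I, ∀ j ∈ I, i.1 = j.1 → i ≠ j → ε * (a / 2 ^ i.1) ≤ dist i.2 j.2
  covers : ∀ y, δ y < a → ∃ i ∈ I, dist y i.2 < ε * (a / 2 ^ i.1)

lemma div_two_pow_le {a : ℝ} (ha : 0 ≤ a) {k l n : ℕ} (h : k + n ≤ l) :
    a / 2 ^ l ≤ a / 2 ^ k / 2 ^ n := by
  rw [div_div, ← pow_add]
  exact div_le_div_of_nonneg_left ha (by positivity) (pow_le_pow_right₀ one_le_two h)

namespace IsWhitneyCover

variable {X : Type*} [MetricSpace X] {δ : X → ℝ} {a ε Q : ℝ} {m : ℕ} {I : Finset (ℕ × X)}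

/-- If the levels differed by two or more, the values of `δ` at the centres would differ by more
than a quarter of `a / 2 ^ j.1`, while dilated balls with a common point have centres closer than
that. The lower bound on `δ` at `j.2` is available because such a `j` is not at the last level. -/
lemma level_le_succ (hI : IsWhitneyCover δ a ε m I) (hδ : ∀ x y, δ x - δ y ≤ dist x y)
    (ha : 0 < a) (hQ : ε * Q ≤ 1 / 8) {i j : ℕ × X} (hi : i ∈ I) (hj : j ∈ I) {y : X}
    (hyi : dist y i.2 < Q * (ε * (a / 2 ^ i.1))) (hyj : dist y j.2 < Q * (ε * (a / 2 ^ j.1))) :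
    i.1 ≤ j.1 + 1 := by
  by_contra! hlt
  have h1 := div_two_pow_le ha.le (show j.1 + 2 ≤ i.1 by omega)
  have h2 := hI.le_gap j hj (by have := hI.level_le i hi; omega)
  have h3 := hI.gap_lt i hi
  have h4 := hδ j.2 i.2
  have h5 := dist_triangle_left j.2 i.2 y
  have hti : 0 < a / 2 ^ i.1 := by positivity
  have htj : 0 < a / 2 ^ j.1 := by positivity
  have h6 : Q * (ε * (a / 2 ^ i.1)) ≤ 1 / 8 * (a / 2 ^ i.1) := by
    rw [← mul_assoc, mul_comm Q]; gcongr
  have h7 : Q * (ε * (a / 2 ^ j.1)) ≤ 1 / 8 * (a / 2 ^ j.1) := by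
    rw [← mul_assoc, mul_comm Q]; gcongr
  norm_num at h1
  linarith

open Classical in
/-- The balls dilated by the factor `Q` have bounded overlap. -/
lemma card_filter_le [MeasurableSpace X] [BorelSpace X] {μ : Measure X} {C : ℝ}
    (hI : IsWhitneyCover δ a ε m I) (hδ : ∀ x y, δ x - δ y ≤ dist x y)
    (ha : 0 < a) (hε : 0 < ε) (hQ : ε * Q ≤ 1 / 8)
    (h : IsDoublingWith μ C) (h0 : ∀ x r, 0 < r → μ (Metric.ball x r) ≠ 0)
    (ht : ∀ x r, μ (Metric.ball x r) ≠ ∞) {n N : ℕ} (hn : 4 * Q + 1 ≤ 2 ^ n)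
    (hN : ENNReal.ofReal C ^ n ≤ N) (y : X) :
    (I.filter fun i => dist y i.2 < Q * (ε * (a / 2 ^ i.1))).card ≤ N * 3 := by
  set S := I.filter fun i => dist y i.2 < Q * (ε * (a / 2 ^ i.1)) with hS
  rcases S.eq_empty_or_nonempty with h1 | ⟨i₀, hi₀⟩
  · simp [h1]
  -- Only three consecutive levels occur among the dilated balls containing `y`, and separation
  -- bounds the number within each.
  have hlev : ∀ i ∈ S, i.1 ∈ Finset.Icc (i₀.1 - 1) (i₀.1 + 1) := fun i hi => by
    obtain ⟨hi1, hi2⟩ := Finset.mem_filter.1 hi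
    obtain ⟨hj1, hj2⟩ := Finset.mem_filter.1 hi₀
    have h2 := hI.level_le_succ hδ ha hQ hi1 hj1 hi2 hj2
    have h3 := hI.level_le_succ hδ ha hQ hj1 hi1 hj2 hi2
    rw [Finset.mem_Icc]; omega
  have hfib : ∀ l ∈ Finset.Icc (i₀.1 - 1) (i₀.1 + 1), (S.filter fun i => i.1 = l).card ≤ N := by
    intro l _
    set T := (S.filter fun i => i.1 = l).image Prod.snd with hT
    have hcard : T.card = (S.filter fun i => i.1 = l).card := by
      refine Finset.card_image_of_injOn fun i hi j hj hij => ?_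
      exact Prod.ext ((Finset.mem_filter.1 hi).2.trans (Finset.mem_filter.1 hj).2.symm) hij
    have hs : 0 < ε * (a / 2 ^ l) := by positivity
    have hle : (T.card : ℝ≥0∞) ≤ ENNReal.ofReal C ^ n := by
      refine h.card_le_of_separated h0 ht hs (ρ := Q * (ε * (a / 2 ^ l))) (y := y) ?_ ?_ ?_
      · nlinarith
      · intro x hx
        obtain ⟨i, hi, rfl⟩ := Finset.mem_image.1 hx
        obtain ⟨hi1, rfl⟩ := Finset.mem_filter.1 hi
        rw [dist_comm]
        exact (Finset.mem_filter.1 hi1).2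
      · intro x hx z hz hxz
        obtain ⟨i, hi, rfl⟩ := Finset.mem_image.1 hx
        obtain ⟨j, hj, rfl⟩ := Finset.mem_image.1 hz
        obtain ⟨hi1, rfl⟩ := Finset.mem_filter.1 hi
        obtain ⟨hj1, hj2⟩ := Finset.mem_filter.1 hj
        exact hI.separated i (Finset.mem_filter.1 hi1).1 j (Finset.mem_filter.1 hj1).1 hj2.symm
          fun hij => hxz (by rw [hij])
    rw [← hcard]
    exact_mod_cast hle.trans hN
  refine (Finset.card_le_mul_card_image_of_maps_to hlev N hfib).trans ?_
  gcongr
  rw [Nat.card_Icc]; omega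

end IsWhitneyCover

/-- Existence of Whitney covers of all depths that agree at common levels. -/
lemma exists_isWhitneyCover {X : Type*} [MetricSpace X] [MeasurableSpace X] [BorelSpace X]
    {μ : Measure X} {C : ℝ} (h : IsDoublingWith μ C)
    (h0 : ∀ x r, 0 < r → μ (Metric.ball x r) ≠ 0) (ht : ∀ x r, μ (Metric.ball x r) ≠ ∞)
    {δ : X → ℝ} {a ε : ℝ} (ha : 0 < a) (hε : 0 < ε) (hb : Bornology.IsBounded {y | δ y < a}) :
    ∃ I : ℕ → Finset (ℕ × X), (∀ m, IsWhitneyCover δ a ε m (I m)) ∧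
      ∀ m n i, i.1 < m → i.1 < n → (i ∈ I m ↔ i ∈ I n) := by
  classical
  have hpow : ∀ k : ℕ, a / 2 ^ k ≤ a := fun k =>
    div_le_self ha.le (one_le_pow₀ one_le_two)
  have hW := fun k : ℕ => h.exists_finset_net h0 ht (s := ε * (a / 2 ^ k)) (by positivity)
    (A := {y | δ y < a / 2 ^ k ∧ a / 2 ^ k / 2 ≤ δ y})
    (hb.subset fun y hy => hy.1.trans_le (hpow k))
  have hJ := fun k : ℕ => h.exists_finset_net h0 ht (s := ε * (a / 2 ^ k)) (by positivity)
    (A := {y | δ y < a / 2 ^ k}) (hb.subset fun y (hy : δ y < _) => hy.trans_le (hpow k))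
  choose W hWmem hWsep hWcov using hW
  choose J hJmem hJsep hJcov using hJ
  -- The nets `W k` of the dyadic shells do not depend on the depth `m`; only the last level uses
  -- the net `J m` of the whole set `δ < a / 2 ^ m`. This gives the agreement of covers of different
  -- depths.
  let V : ℕ → ℕ → Finset X := fun m k => if k < m then W k else if k = m then J k else ∅
  let I : ℕ → Finset (ℕ × X) := fun m =>
    (Finset.range (m + 1)).biUnion fun k => (V m k).image (Prod.mk k)
  have hmem : ∀ m (i : ℕ × X), i ∈ I m ↔ (i.1 < m ∧ i.2 ∈ W i.1) ∨ (i.1 = m ∧ i.2 ∈ J i.1) := by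
    rintro m ⟨k, x⟩
    simp only [I, Finset.mem_biUnion, Finset.mem_range, Finset.mem_image, Prod.mk.injEq,
      exists_eq_right_right]
    constructor
    · rintro ⟨hl, hx⟩
      rcases Nat.lt_succ_iff_lt_or_eq.1 hl with hl | rfl
      · left; simpa [V, hl] using hx
      · right; simpa [V] using hx
    · rintro (⟨hk, hx⟩ | ⟨rfl, hx⟩)
      · exact ⟨by omega, by simpa [V, hk] using hx⟩
      · exact ⟨by omega, by simpa [V] using hx⟩
  refine ⟨I, fun m => ⟨?_, ?_, ?_, ?_, ?_⟩, ?_⟩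
  · intro i hi
    rcases (hmem m i).1 hi with h | h <;> omega
  · intro i hi
    rcases (hmem m i).1 hi with h | h
    exacts [(hWmem _ _ h.2).1, hJmem _ _ h.2]
  · intro i hi hlt
    rcases (hmem m i).1 hi with h | h
    · exact (hWmem _ _ h.2).2
    · omega
  · rintro ⟨k, x⟩ hi ⟨l, z⟩ hj (rfl : k = l) hne
    have hxz : x ≠ z := fun h => hne (by rw [h])
    rcases (hmem m _).1 hi with h | h <;> rcases (hmem m _).1 hj with h' | h'
    · exact hWsep k x h.2 z h'.2 hxz
    · omega
    · omega
    · exact hJsep k x h.2 z h'.2 hxz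
  · intro y hy
    by_cases hlow : δ y < a / 2 ^ m
    · obtain ⟨x, hx, hd⟩ := hJcov m y hlow
      exact ⟨(m, x), (hmem m _).2 (Or.inr ⟨rfl, hx⟩), hd⟩
    · have hex : ∃ k, a / 2 ^ k ≤ δ y := ⟨m, not_lt.1 hlow⟩
      -- The shell of `y` has level `k - 1`, where `k` is the first exponent with `a / 2 ^ k ≤ δ y`.
      set k := Nat.find hex with hk
      have hk1 := Nat.find_spec hex
      have hk0 : k ≠ 0 := fun h => by
        rw [← hk, h] at hk1
        simp at hk1
        linarith
      obtain ⟨l, hl⟩ := Nat.exists_eq_succ_of_ne_zero hk0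
      have hlm : l < m := by
        have := Nat.find_min' hex (not_lt.1 hlow)
        omega
      have hl1 : δ y < a / 2 ^ l := not_le.1 (Nat.find_min hex (by omega))
      have hl2 : a / 2 ^ l / 2 ≤ δ y := by
        rw [← hk, hl, Nat.succ_eq_add_one, pow_succ, ← div_div] at hk1
        exact hk1
      obtain ⟨x, hx, hd⟩ := hWcov l y ⟨hl1, hl2⟩
      exact ⟨(l, x), (hmem m _).2 (Or.inl ⟨hlm, hx⟩), hd⟩
  · intro m n i hm hn
    rw [hmem, hmem]
    have := hm.ne
    have := hn.ne
    tauto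

/-! ### Regular scale functions -/

lemma AdmissibleRadius.mono {X : Type*} [MetricSpace X] {r s : ℝ} (h : AdmissibleRadius X r)
    (hs : 0 < s) (hsr : s ≤ r) : AdmissibleRadius X s :=
  ⟨hs, (ENNReal.ofReal_le_ofReal hsr).trans h.2⟩

namespace IsRegularScale

variable {X : Type*} [MetricSpace X] {Ψ : X → ℝ → ℝ} {C βm βp : ℝ}

/-- The scale condition only compares a larger radius with a smaller one, so the case `s ≤ r` uses
the upper bound and the case `r ≤ s` the lower bound with the roles exchanged. -/
lemma le_of_comparable (h : IsRegularScale Ψ C βm βp) (hC : 0 < C) (hβm : 0 < βm)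
    (hβp : 0 < βp) {x y : X} {r s K : ℝ} (hr : AdmissibleRadius X r) (hs : AdmissibleRadius X s)
    (hK : 1 ≤ K) (hrs : r ≤ K * s) (hd : dist x y ≤ K * s) :
    Ψ x r ≤ C * K ^ βp * Ψ y s := by
  have hr0 := hr.1
  have hs0 := hs.1
  have hK0 : 0 < K := by linarith
  rcases le_total s r with hle | hle
  · have h1 := h.upper x y s r hs0 hle hr
    rw [div_le_iff₀ (h.pos y s hs0)] at h1
    refine h1.trans ?_
    have hm : 0 < max r (dist x y) := lt_max_of_lt_left hr0
    have h2 : (r / max r (dist x y)) ^ βm ≤ 1 :=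
      Real.rpow_le_one (by positivity) ((div_le_one hm).2 (le_max_left _ _)) hβm.le
    have h3 : (max r (dist x y) / s) ^ βp ≤ K ^ βp := by
      refine Real.rpow_le_rpow (by positivity) ?_ hβp.le
      exact (div_le_iff₀ hs0).2 (max_le hrs hd)
    have := (h.pos y s hs0).le
    calc C * (r / max r (dist x y)) ^ βm * (max r (dist x y) / s) ^ βp * Ψ y s
        ≤ C * 1 * K ^ βp * Ψ y s := by gcongr
      _ = _ := by ring
  · have h1 := h.lower y x r s hr0 hle hs
    have hm : 0 < max s (dist y x) := lt_max_of_lt_left hs0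
    have h2 : 1 ≤ (max s (dist y x) / r) ^ βm :=
      Real.one_le_rpow ((one_le_div hr0).2 (hle.trans (le_max_left _ _))) hβm.le
    have h3 : (K ^ βp)⁻¹ ≤ (s / max s (dist y x)) ^ βp := by
      rw [← Real.inv_rpow hK0.le]
      refine Real.rpow_le_rpow (by positivity) ?_ hβp.le
      rw [inv_le_comm₀ hK0 (by positivity), inv_div, div_le_iff₀ hs0, dist_comm]
      exact max_le (by nlinarith) hd
    rw [le_div_iff₀ (h.pos x r hr0)] at h1
    have hx := (h.pos x r hr0).le
    have h4 : C⁻¹ * (K ^ βp)⁻¹ * 1 * Ψ x r ≤ Ψ y s := le_trans (by gcongr) h1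
    have hKp : 0 < K ^ βp := by positivity
    calc Ψ x r = C * K ^ βp * (C⁻¹ * (K ^ βp)⁻¹ * 1 * Ψ x r) := by field_simp
      _ ≤ _ := by gcongr

/-- The lower scale bound turns a small ratio `r / R` into decay of `Ψ`; this makes the
approximation error tend to zero. -/
lemma le_decay (h : IsRegularScale Ψ C βm βp) (hC : 0 < C) (hβm : 0 < βm)
    (hβp : 0 < βp) {x₀ x : X} {r R : ℝ} (hr : 0 < r) (hrR : r ≤ R) (hR : AdmissibleRadius X R)
    (hd : dist x₀ x ≤ 2 * R) :
    Ψ x r ≤ C * 2 ^ βp * (r / R) ^ βm * Ψ x₀ R := by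
  have hR0 := hR.1
  have h1 := h.lower x₀ x r R hr hrR hR
  have hm : 0 < max R (dist x₀ x) := lt_max_of_lt_left hR0
  have h2 : (R / r) ^ βm ≤ (max R (dist x₀ x) / r) ^ βm := by
    gcongr
    exact le_max_left _ _
  have h3 : ((2 : ℝ) ^ βp)⁻¹ ≤ (R / max R (dist x₀ x)) ^ βp := by
    rw [← Real.inv_rpow two_pos.le]
    refine Real.rpow_le_rpow (by positivity) ?_ hβp.le
    rw [inv_le_comm₀ two_pos (by positivity), inv_div, div_le_iff₀ hR0]
    exact max_le (by linarith) hd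
  rw [le_div_iff₀ (h.pos x r hr)] at h1
  have hx := (h.pos x r hr).le
  have h4 : C⁻¹ * ((2 : ℝ) ^ βp)⁻¹ * (R / r) ^ βm * Ψ x r ≤ Ψ x₀ R := le_trans (by gcongr) h1
  have h5 : (r / R) ^ βm * (R / r) ^ βm = 1 := by
    rw [← Real.mul_rpow (by positivity) (by positivity)]
    rw [div_mul_div_cancel₀ hR0.ne', div_self hr.ne', Real.one_rpow]
  have h2p : (0 : ℝ) < 2 ^ βp := by positivity
  calc Ψ x r = C * 2 ^ βp * (r / R) ^ βm * (C⁻¹ * ((2 : ℝ) ^ βp)⁻¹ * (R / r) ^ βm * Ψ x r) := by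
        rw [show C * 2 ^ βp * (r / R) ^ βm * (C⁻¹ * ((2 : ℝ) ^ βp)⁻¹ * (R / r) ^ βm * Ψ x r)
          = (C * C⁻¹) * (2 ^ βp * ((2 : ℝ) ^ βp)⁻¹) * ((r / R) ^ βm * (R / r) ^ βm) * Ψ x r by ring,
          h5, mul_inv_cancel₀ hC.ne', mul_inv_cancel₀ h2p.ne']
        ring
    _ ≤ _ := by gcongr

end IsRegularScale

lemma enorm_sub_rpow_le {p : ℝ} (hp : 1 ≤ p) (a b c : ℝ) :
    ‖a - b‖ₑ ^ p ≤ 2 ^ (p - 1) * (‖a - c‖ₑ ^ p + ‖b - c‖ₑ ^ p) := by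
  refine le_trans ?_ (ENNReal.rpow_add_le_mul_rpow_add_rpow _ _ hp)
  gcongr
  rw [show a - b = (a - c) - (b - c) by ring]
  exact enorm_sub_le

/-! ### Mean values and the Poincaré inequality -/

/-- Standing assumptions: positivity of the constants, non-degeneracy of the doubling measure,
capacity upper bound and Poincaré inequality. -/
structure PDirichletSpace.IsControlled {X : Type*} [MetricSpace X] [MeasurableSpace X]
    [BorelSpace X] {μ : Measure X} {p : ℝ} (D : PDirichletSpace μ p) (Ψ : X → ℝ → ℝ)
    (CD Ccap CPI Λ CΨ βm βp : ℝ) : Prop where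
  one_lt : 1 < p
  CΨ_pos : 0 < CΨ
  βm_pos : 0 < βm
  βp_pos : 0 < βp
  doubling : IsDoublingWith μ CD
  scale : IsRegularScale Ψ CΨ βm βp
  cap : D.CapUpperBound Ψ Ccap
  poincare : D.PoincareInequality Ψ CPI Λ
  ball_ne_zero : ∀ x r, 0 < r → μ (Metric.ball x r) ≠ 0
  ball_ne_top : ∀ x r, μ (Metric.ball x r) ≠ ∞

namespace PDirichletSpace.IsControlled

variable {X : Type*} [MetricSpace X] [MeasurableSpace X] [BorelSpace X]
  {μ : Measure X} {p : ℝ} {D : PDirichletSpace μ p} {Ψ : X → ℝ → ℝ}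
  {CD Ccap CPI Λ CΨ βm βp : ℝ}

lemma integrableOn (h : D.IsControlled Ψ CD Ccap CPI Λ CΨ βm βp)
    (u : Lp ℝ (ENNReal.ofReal p) μ) (x : X) (r : ℝ) :
    IntegrableOn u (Metric.ball x r) μ := by
  have : IsFiniteMeasure (μ.restrict (Metric.ball x r)) :=
    ⟨by simpa using (h.ball_ne_top x r).lt_top⟩
  refine ((Lp.memLp u).restrict _).integrable ?_
  rw [ENNReal.one_le_ofReal]; exact h.one_lt.le

lemma lintegral_sub_mean_le (h : D.IsControlled Ψ CD Ccap CPI Λ CΨ βm βp) (u : D.domain)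
    {x : X} {r : ℝ} (hr : AdmissibleRadius X r) :
    ∫⁻ y in Metric.ball x r, ‖(u : Lp ℝ (ENNReal.ofReal p) μ) y -
        ⨍ z in Metric.ball x r, (u : Lp ℝ (ENNReal.ofReal p) μ) z ∂μ‖ₑ ^ p ∂μ ≤
      ENNReal.ofReal CPI * ENNReal.ofReal (Ψ x r) * D.Γ u (Metric.ball x (Λ * r)) := by
  have h0 := h.ball_ne_zero x r hr.1
  have ht := h.ball_ne_top x r
  have h1 := h.poincare x r hr u
  rw [setLAverage_eq, ENNReal.div_le_iff h0 ht] at h1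
  refine h1.trans (le_of_eq ?_)
  rw [ENNReal.div_eq_inv_mul]
  calc _ = (μ (Metric.ball x r))⁻¹ * μ (Metric.ball x r) * (ENNReal.ofReal CPI *
        ENNReal.ofReal (Ψ x r) * D.Γ u (Metric.ball x (Λ * r))) := by ring
    _ = _ := by rw [ENNReal.inv_mul_cancel h0 ht, one_mul]

/-- Jensen's inequality bounds the difference by an integral over the small ball; enlarging it to
the big ball costs only the measure ratio `M`, and the Poincaré inequality applies there. -/
lemma mean_sub_mean_le (h : D.IsControlled Ψ CD Ccap CPI Λ CΨ βm βp) (u : D.domain)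
    {x y : X} {r s : ℝ} (hr : AdmissibleRadius X r) (hs : 0 < s)
    (hsub : Metric.ball y s ⊆ Metric.ball x r) {M : ℝ≥0∞}
    (hM : μ (Metric.ball x r) ≤ M * μ (Metric.ball y s)) :
    ‖(⨍ z in Metric.ball y s, (u : Lp ℝ (ENNReal.ofReal p) μ) z ∂μ) -
        ⨍ z in Metric.ball x r, (u : Lp ℝ (ENNReal.ofReal p) μ) z ∂μ‖ₑ ^ p *
        μ (Metric.ball x r) ≤
      M * (ENNReal.ofReal CPI * ENNReal.ofReal (Ψ x r) * D.Γ u (Metric.ball x (Λ * r))) := by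
  have h0 := h.ball_ne_zero y s hs
  have ht := h.ball_ne_top y s
  have h1 := enorm_setAverage_sub_rpow_le h.one_lt.le h0 ht (h.integrableOn u y s)
    (⨍ z in Metric.ball x r, (u : Lp ℝ (ENNReal.ofReal p) μ) z ∂μ)
  refine (mul_le_mul' h1 hM).trans ?_
  calc _ = (μ (Metric.ball y s))⁻¹ * μ (Metric.ball y s) * (M * ∫⁻ z in Metric.ball y s,
        ‖(u : Lp ℝ (ENNReal.ofReal p) μ) z -
          ⨍ z in Metric.ball x r, (u : Lp ℝ (ENNReal.ofReal p) μ) z ∂μ‖ₑ ^ p ∂μ) := by ring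
    _ ≤ _ := by
      rw [ENNReal.inv_mul_cancel h0 ht, one_mul]
      gcongr
      exact (lintegral_mono_set hsub).trans (h.lintegral_sub_mean_le u hr)

lemma lintegral_sub_mean_subball_le (h : D.IsControlled Ψ CD Ccap CPI Λ CΨ βm βp) (u : D.domain)
    {x y : X} {r s : ℝ} (hr : AdmissibleRadius X r) (hs : 0 < s)
    (hsub : Metric.ball y s ⊆ Metric.ball x r) {M : ℝ≥0∞}
    (hM : μ (Metric.ball x r) ≤ M * μ (Metric.ball y s)) :
    ∫⁻ w in Metric.ball x r, ‖(⨍ z in Metric.ball y s, (u : Lp ℝ (ENNReal.ofReal p) μ) z ∂μ) -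
        (u : Lp ℝ (ENNReal.ofReal p) μ) w‖ₑ ^ p ∂μ ≤
      2 ^ (p - 1) * ((M + 1) *
        (ENNReal.ofReal CPI * ENNReal.ofReal (Ψ x r) * D.Γ u (Metric.ball x (Λ * r)))) := by
  set c := ⨍ z in Metric.ball x r, (u : Lp ℝ (ENNReal.ofReal p) μ) z ∂μ with hc
  have h1 := h.mean_sub_mean_le u hr hs hsub hM
  have h2 := h.lintegral_sub_mean_le u (x := x) hr
  rw [← hc] at h1 h2
  refine (lintegral_mono fun w => enorm_sub_rpow_le h.one_lt.le _ _ c).trans ?_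
  rw [lintegral_const_mul' _ _ (by finiteness), lintegral_add_left measurable_const,
    setLIntegral_const, add_mul, one_mul]
  gcongr

/-- Normalized cutoff functions with controlled energy. -/
lemma exists_cutoff (h : D.IsControlled Ψ CD Ccap CPI Λ CΨ βm βp) {x : X} {r : ℝ}
    (hr : AdmissibleRadius X r) :
    ∃ (f : D.domain) (ψ : X → ℝ), D.IsRep f ψ ∧ (∀ y, 0 ≤ ψ y) ∧
      (∀ y, dist y x < r → ψ y = 1) ∧ (∀ y, ψ y ≠ 0 → dist y x < 2 * r) ∧
      D.Γ f univ ≤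
        ENNReal.ofReal Ccap * (μ (Metric.ball x r) / ENNReal.ofReal (Ψ x r)) := by
  obtain ⟨f, φ, -, hrep, h1, h0, -, hE⟩ := h.cap x r hr
  refine ⟨D.clamp f, _, isRep_clamp hrep, fun y => unitClamp_nonneg _, fun y hy => ?_,
    fun y hy => ?_, (gamma_clamp_le _ _).trans hE⟩
  · rw [h1 y hy, unitClamp_one]
  · by_contra hcon
    exact hy (by rw [h0 y hcon, unitClamp_zero])

end PDirichletSpace.IsControlled

/-- The balls `B(x, r)` and `B(y, s)` have comparable radii and are close to each other. -/
structure AreNeighbors {X : Type*} [MetricSpace X] (x : X) (r : ℝ) (y : X) (s : ℝ) : Prop where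
  left_le : r ≤ 2 * s
  right_le : s ≤ 2 * r
  dist_lt_left : dist x y < 8 * r
  dist_lt_right : dist x y < 8 * s

lemma AreNeighbors.symm {X : Type*} [MetricSpace X] {x y : X} {r s : ℝ}
    (h : AreNeighbors x r y s) : AreNeighbors y s x r :=
  ⟨h.right_le, h.left_le, by rw [dist_comm]; exact h.dist_lt_right,
    by rw [dist_comm]; exact h.dist_lt_left⟩

/-- Comparison constant for the ratios `μ(B) / Ψ(B)` of neighboring balls. -/
def ratioConst (CD CΨ βp : ℝ) : ℝ≥0∞ := ENNReal.ofReal CD ^ 4 * ENNReal.ofReal (CΨ * 8 ^ βp)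

/-- Constant in the estimate of the oscillation of means over neighboring balls. -/
def oscConst (CD CPI CΨ βp : ℝ) : ℝ≥0∞ :=
  ENNReal.ofReal CD ^ 6 * ENNReal.ofReal CPI * ENNReal.ofReal (CΨ * 16 ^ βp)

/-- Constant in the estimate of means over balls of radius comparable to the largest one. -/
def meanConst (CD CΨ βp K : ℝ) : ℝ≥0∞ := ENNReal.ofReal CD ^ 4 * ENNReal.ofReal (CΨ * K ^ βp)

lemma IsDoublingWith.measure_ball_le_of_areNeighbors {X : Type*} [MetricSpace X]
    [MeasurableSpace X] {μ : Measure X} {C : ℝ} (h : IsDoublingWith μ C) {x y : X} {r s : ℝ}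
    (hn : AreNeighbors x r y s) (hs : 0 < s) :
    μ (Metric.ball x r) ≤ ENNReal.ofReal C ^ 4 * μ (Metric.ball y s) := by
  -- Here `r + dist x y ≤ 2 * s + 8 * s ≤ 2 ^ 4 * s`.
  refine h.measure_ball_le hs 4 ?_
  linarith [hn.left_le, hn.dist_lt_right]

namespace PDirichletSpace.IsControlled

variable {X : Type*} [MetricSpace X] [MeasurableSpace X] [BorelSpace X]
  {μ : Measure X} {p : ℝ} {D : PDirichletSpace μ p} {Ψ : X → ℝ → ℝ}
  {CD Ccap CPI Λ CΨ βm βp : ℝ}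

lemma inv_scale_le (h : D.IsControlled Ψ CD Ccap CPI Λ CΨ βm βp) {x y : X} {r s K : ℝ}
    (hr : AdmissibleRadius X r) (hs : AdmissibleRadius X s)
    (hK : 1 ≤ K) (hrs : r ≤ K * s) (hd : dist x y ≤ K * s) :
    (ENNReal.ofReal (Ψ y s))⁻¹ ≤ ENNReal.ofReal (CΨ * K ^ βp) * (ENNReal.ofReal (Ψ x r))⁻¹ := by
  have hx : ENNReal.ofReal (Ψ x r) ≠ 0 := (ENNReal.ofReal_pos.2 (h.scale.pos x r hr.1)).ne'
  have hy : ENNReal.ofReal (Ψ y s) ≠ 0 := (ENNReal.ofReal_pos.2 (h.scale.pos y s hs.1)).ne'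
  have h1 := ENNReal.ofReal_le_ofReal
    (h.scale.le_of_comparable h.CΨ_pos h.βm_pos h.βp_pos hr hs hK hrs hd)
  have hCK : 0 ≤ CΨ * K ^ βp := by have := h.CΨ_pos; positivity
  rw [ENNReal.ofReal_mul hCK] at h1
  rw [← ENNReal.div_eq_inv_mul.trans (mul_comm _ _),
    ENNReal.le_div_iff_mul_le (Or.inl hx) (Or.inl ENNReal.ofReal_ne_top), mul_comm,
    ← ENNReal.div_eq_inv_mul.trans (mul_comm _ _)]
  exact (ENNReal.div_le_iff hy ENNReal.ofReal_ne_top).2 h1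

lemma ratio_le (h : D.IsControlled Ψ CD Ccap CPI Λ CΨ βm βp) {x y : X} {r s : ℝ}
    (hr : AdmissibleRadius X r) (hs : AdmissibleRadius X s) (hn : AreNeighbors x r y s) :
    μ (Metric.ball y s) / ENNReal.ofReal (Ψ y s) ≤
      ratioConst CD CΨ βp * (μ (Metric.ball x r) / ENNReal.ofReal (Ψ x r)) := by
  have h1 := h.doubling.measure_ball_le_of_areNeighbors hn.symm hr.1
  have h2 := h.inv_scale_le (x := x) (y := y) hr hs (K := 8) (by norm_num)
    (by linarith [hn.left_le, hs.1]) hn.dist_lt_right.le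
  rw [div_eq_mul_inv, div_eq_mul_inv, ratioConst]
  refine (mul_le_mul' h1 h2).trans (le_of_eq ?_)
  ring

/-- The factor `Ψ` from the Poincaré inequality cancels the `Ψ` in the energy of a cutoff, leaving a
scale-free bound by the energy of `u`. -/
lemma osc_mul_ratio_le (h : D.IsControlled Ψ CD Ccap CPI Λ CΨ βm βp) (u : D.domain)
    {x y : X} {r s Q : ℝ} (hr : AdmissibleRadius X (16 * r)) (hr0 : 0 < r) (hs : 0 < s)
    (hn : AreNeighbors x r y s) (hQ : 16 * Λ ≤ Q) :
    ‖(⨍ z in Metric.ball y s, (u : Lp ℝ (ENNReal.ofReal p) μ) z ∂μ) -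
        ⨍ z in Metric.ball x (16 * r), (u : Lp ℝ (ENNReal.ofReal p) μ) z ∂μ‖ₑ ^ p *
        (μ (Metric.ball x r) / ENNReal.ofReal (Ψ x r)) ≤
      oscConst CD CPI CΨ βp * D.Γ u (Metric.ball x (Q * r)) := by
  have hM : μ (Metric.ball x (16 * r)) ≤ ENNReal.ofReal CD ^ 6 * μ (Metric.ball y s) := by
    refine h.doubling.measure_ball_le hs 6 ?_
    linarith [hn.left_le, hn.dist_lt_right]
  have hsub : Metric.ball y s ⊆ Metric.ball x (16 * r) := by
    refine Metric.ball_subset_ball' ?_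
    rw [dist_comm]; linarith [hn.right_le, hn.dist_lt_left]
  have h1 := h.mean_sub_mean_le u hr hs hsub hM
  have hr1 : AdmissibleRadius X r := hr.mono hr0 (by linarith)
  have h2 : ENNReal.ofReal (Ψ x (16 * r)) ≤
      ENNReal.ofReal (CΨ * 16 ^ βp) * ENNReal.ofReal (Ψ x r) := by
    rw [← ENNReal.ofReal_mul (by have := h.CΨ_pos; positivity)]
    exact ENNReal.ofReal_le_ofReal (h.scale.le_of_comparable h.CΨ_pos h.βm_pos h.βp_pos hr hr1
      (by norm_num) le_rfl (by rw [dist_self]; positivity))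
  have hx : ENNReal.ofReal (Ψ x r) ≠ 0 := (ENNReal.ofReal_pos.2 (h.scale.pos x r hr0)).ne'
  have hsub' : Metric.ball x (Λ * (16 * r)) ⊆ Metric.ball x (Q * r) :=
    Metric.ball_subset_ball (by nlinarith)
  rw [← mul_div_assoc, ENNReal.div_le_iff hx ENNReal.ofReal_ne_top]
  calc _ ≤ _ := by gcongr; linarith
    _ ≤ _ := h1
    _ ≤ ENNReal.ofReal CD ^ 6 * (ENNReal.ofReal CPI *
        (ENNReal.ofReal (CΨ * 16 ^ βp) * ENNReal.ofReal (Ψ x r)) *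
        D.Γ u (Metric.ball x (Q * r))) := by
      gcongr
    _ = _ := by rw [oscConst]; ring

/-- This serves the balls of level zero, where no constant may be subtracted: Jensen's inequality
about `0` replaces Poincaré, and `Ψ x r` is traded for `Ψ x₀ R` because `r` is comparable to `R`. -/
lemma mean_mul_ratio_le (h : D.IsControlled Ψ CD Ccap CPI Λ CΨ βm βp) (u : D.domain)
    {x₀ x y : X} {R r s Q K : ℝ} (hR : AdmissibleRadius X R) (hr : AdmissibleRadius X r)
    (hs : 0 < s) (hn : AreNeighbors x r y s) (hK : 1 ≤ K) (hRr : R ≤ K * r)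
    (hd : dist x₀ x ≤ K * r) (hQ : 16 ≤ Q) :
    ‖⨍ z in Metric.ball y s, (u : Lp ℝ (ENNReal.ofReal p) μ) z ∂μ‖ₑ ^ p *
        (μ (Metric.ball x r) / ENNReal.ofReal (Ψ x r)) ≤
      meanConst CD CΨ βp K * ((ENNReal.ofReal (Ψ x₀ R))⁻¹ *
        ∫⁻ z in Metric.ball x (Q * r), ‖(u : Lp ℝ (ENNReal.ofReal p) μ) z‖ₑ ^ p ∂μ) := by
  have h0 := h.ball_ne_zero y s hs
  have ht := h.ball_ne_top y s
  have h1 := enorm_setAverage_sub_rpow_le h.one_lt.le h0 ht (h.integrableOn u y s) 0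
  simp only [sub_zero] at h1
  have h2 := h.doubling.measure_ball_le_of_areNeighbors hn hs
  have h3 := h.inv_scale_le (x := x₀) (y := x) hR hr hK hRr hd
  have hsub : Metric.ball y s ⊆ Metric.ball x (Q * r) := by
    refine Metric.ball_subset_ball' ?_
    rw [dist_comm]
    have := hr.1
    nlinarith [hn.right_le, hn.dist_lt_left]
  rw [div_eq_mul_inv]
  refine (mul_le_mul' h1 (mul_le_mul' h2 h3)).trans ?_
  calc _ = (μ (Metric.ball y s))⁻¹ * μ (Metric.ball y s) * (meanConst CD CΨ βp K *
        ((ENNReal.ofReal (Ψ x₀ R))⁻¹ *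
        ∫⁻ z in Metric.ball y s, ‖(u : Lp ℝ (ENNReal.ofReal p) μ) z‖ₑ ^ p ∂μ)) := by
        rw [meanConst]; ring
    _ ≤ _ := by
      rw [ENNReal.inv_mul_cancel h0 ht, one_mul]
      gcongr

end PDirichletSpace.IsControlled

/-! ### The energy of the blended function -/

/-- Constraints on the parameters of a Whitney cover of the annulus of inner radius `R` and width
`a`: the balls have radii `ε * (a / 2 ^ k)` and are dilated by the factor `Q`. -/
structure IsWhitneyScale (X : Type*) [MetricSpace X] (R a ε Q κ Λ : ℝ) : Prop where
  adm : AdmissibleRadius X R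
  a_pos : 0 < a
  ε_pos : 0 < ε
  two_a_le : 2 * a ≤ R
  sixteen_le : 16 ≤ Q
  mul_le : 16 * Λ ≤ Q
  small : ε * Q ≤ 1 / 8
  R_le : R ≤ κ * a

/-- The radius of the ball with index `i`. -/
def whitneyRadius {X : Type*} (a ε : ℝ) (i : ℕ × X) : ℝ := ε * (a / 2 ^ i.1)

/-- A family of cutoff functions adapted to the balls of a Whitney cover. -/
structure PDirichletSpace.IsCutoffFamily {X : Type*} [MetricSpace X] [MeasurableSpace X]
    [BorelSpace X] {μ : Measure X} {p : ℝ} (D : PDirichletSpace μ p) (Ψ : X → ℝ → ℝ)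
    (Ccap a ε : ℝ) (f : ℕ × X → D.domain) (ψ : ℕ × X → X → ℝ) : Prop where
  rep : ∀ i, D.IsRep (f i) (ψ i)
  nonneg : ∀ i y, 0 ≤ ψ i y
  eq_one : ∀ i y, dist y i.2 < whitneyRadius a ε i → ψ i y = 1
  supp : ∀ i y, ψ i y ≠ 0 → dist y i.2 < 2 * whitneyRadius a ε i
  energy : ∀ i, D.Γ (f i) univ ≤ ENNReal.ofReal Ccap *
    (μ (Metric.ball i.2 (whitneyRadius a ε i)) / ENNReal.ofReal (Ψ i.2 (whitneyRadius a ε i)))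

namespace IsWhitneyScale

variable {X : Type*} [MetricSpace X] {R a ε Q κ Λ : ℝ}

lemma radius_pos (h : IsWhitneyScale X R a ε Q κ Λ) (i : ℕ × X) : 0 < whitneyRadius a ε i := by
  have := h.a_pos
  have := h.ε_pos
  rw [whitneyRadius]; positivity

lemma mul_radius_le (h : IsWhitneyScale X R a ε Q κ Λ) (i : ℕ × X) :
    Q * whitneyRadius a ε i ≤ a / 2 ^ i.1 / 8 := by
  have h1 : 0 < a / 2 ^ i.1 := by have := h.a_pos; positivity
  have := h.small
  rw [whitneyRadius]
  nlinarith

lemma div_le (h : IsWhitneyScale X R a ε Q κ Λ) (k : ℕ) : a / 2 ^ k ≤ a :=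
  div_le_self h.a_pos.le (one_le_pow₀ one_le_two)

lemma sixteen_mul_radius_le (h : IsWhitneyScale X R a ε Q κ Λ) (i : ℕ × X) :
    16 * whitneyRadius a ε i ≤ a / 2 ^ i.1 / 8 :=
  (mul_le_mul_of_nonneg_right h.sixteen_le (h.radius_pos i).le).trans (h.mul_radius_le i)

lemma adm_sixteen (h : IsWhitneyScale X R a ε Q κ Λ) (i : ℕ × X) :
    AdmissibleRadius X (16 * whitneyRadius a ε i) := by
  refine h.adm.mono (mul_pos (by norm_num) (h.radius_pos i)) ?_
  linarith [h.sixteen_mul_radius_le i, h.div_le i.1, h.two_a_le, h.a_pos]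

lemma adm_radius (h : IsWhitneyScale X R a ε Q κ Λ) (i : ℕ × X) :
    AdmissibleRadius X (whitneyRadius a ε i) :=
  (h.adm_sixteen i).mono (h.radius_pos i) (by linarith [h.radius_pos i])

lemma radius_le_two_mul (h : IsWhitneyScale X R a ε Q κ Λ) {i j : ℕ × X} (hij : j.1 ≤ i.1 + 1) :
    whitneyRadius a ε i ≤ 2 * whitneyRadius a ε j := by
  have h1 := div_two_pow_le h.a_pos.le (show j.1 + 0 ≤ i.1 + 1 by omega)
  have := h.ε_pos
  rw [pow_succ, ← div_div] at h1
  rw [whitneyRadius, whitneyRadius]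
  norm_num at h1
  nlinarith

lemma ball_subset (h : IsWhitneyScale X R a ε Q κ Λ) {x₀ : X} {m : ℕ} {I : Finset (ℕ × X)}
    (hI : IsWhitneyCover (fun y => dist y x₀ - R) a ε m I) {i : ℕ × X} (hi : i ∈ I) :
    Metric.ball i.2 (Q * whitneyRadius a ε i) ⊆ Metric.ball x₀ (R + 2 * a) := by
  refine Metric.ball_subset_ball' ?_
  have := h.mul_radius_le i
  have := hI.gap_lt i hi
  linarith [h.div_le i.1, h.a_pos]

lemma areNeighbors (h : IsWhitneyScale X R a ε Q κ Λ) {δ : X → ℝ} {m : ℕ} {I : Finset (ℕ × X)}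
    (hI : IsWhitneyCover δ a ε m I) (hδ : ∀ x y, δ x - δ y ≤ dist x y) {i j : ℕ × X}
    (hi : i ∈ I) (hj : j ∈ I) {y : X} (hyi : dist y i.2 < 3 * whitneyRadius a ε i)
    (hyj : dist y j.2 < 2 * whitneyRadius a ε j) :
    AreNeighbors i.2 (whitneyRadius a ε i) j.2 (whitneyRadius a ε j) := by
  have hi0 := h.radius_pos i
  have hj0 := h.radius_pos j
  have hQ := h.sixteen_le
  have h1 : dist y i.2 < Q * whitneyRadius a ε i := by nlinarith
  have h2 : dist y j.2 < Q * whitneyRadius a ε j := by nlinarith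
  have h3 := h.radius_le_two_mul (hI.level_le_succ hδ h.a_pos h.small hi hj h1 h2)
  have h4 := h.radius_le_two_mul (hI.level_le_succ hδ h.a_pos h.small hj hi h2 h1)
  have h5 := dist_triangle_left i.2 j.2 y
  exact ⟨h4, h3, by linarith, by linarith⟩

end IsWhitneyScale

/-- The mean value of `u` over the ball with index `i`. -/
def whitneyMean {X : Type*} [MetricSpace X] [MeasurableSpace X] (μ : Measure X) (u : X → ℝ)
    (a ε : ℝ) (i : ℕ × X) : ℝ :=
  ⨍ z in Metric.ball i.2 (whitneyRadius a ε i), u z ∂μ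

/-- The measure `Γ⟨u⟩ + Ψ₀⁻¹ |u| ^ p dμ`. -/
def PDirichletSpace.sobolevMeasure {X : Type*} [MetricSpace X] [MeasurableSpace X]
    [BorelSpace X] {μ : Measure X} {p : ℝ} (D : PDirichletSpace μ p) (Ψ₀ : ℝ) (u : D.domain) :
    Measure X :=
  D.Γ u + (ENNReal.ofReal Ψ₀)⁻¹ •
    μ.withDensity (fun z => ‖(u : Lp ℝ (ENNReal.ofReal p) μ) z‖ₑ ^ p)

lemma PDirichletSpace.sobolevMeasure_apply {X : Type*} [MetricSpace X] [MeasurableSpace X]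
    [BorelSpace X] {μ : Measure X} {p : ℝ} (D : PDirichletSpace μ p) (Ψ₀ : ℝ) (u : D.domain)
    {A : Set X} (hA : MeasurableSet A) :
    D.sobolevMeasure Ψ₀ u A = D.Γ u A + (ENNReal.ofReal Ψ₀)⁻¹ *
      ∫⁻ z in A, ‖(u : Lp ℝ (ENNReal.ofReal p) μ) z‖ₑ ^ p ∂μ := by
  simp [sobolevMeasure, withDensity_apply _ hA]

/-- Energy constant of the functions in the partition of unity. -/
def partConst (p CD Ccap CΨ βp : ℝ) (N : ℕ) : ℝ≥0∞ :=
  2 ^ (p - 1) * (2 * ((N : ℝ≥0∞) ^ (p - 1) * (N * (ENNReal.ofReal Ccap * ratioConst CD CΨ βp))))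

/-- Energy constant of the blended function on one ball of the cover. -/
def localConst (p CD Ccap CPI CΨ βp K : ℝ) (N : ℕ) : ℝ≥0∞ :=
  (N : ℝ≥0∞) ^ (p - 1) * (N * (partConst p CD Ccap CΨ βp N * ratioConst CD CΨ βp *
    (oscConst CD CPI CΨ βp + meanConst CD CΨ βp K)))

/-- Energy constant of the blended function. -/
def blendConst (p CD Ccap CPI CΨ βp K : ℝ) (N : ℕ) : ℝ≥0∞ :=
  localConst p CD Ccap CPI CΨ βp K N * N

lemma blendConst_ne_top {p : ℝ} (hp : 1 ≤ p) (CD Ccap CPI CΨ βp K : ℝ) (N : ℕ) :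
    blendConst p CD Ccap CPI CΨ βp K N ≠ ∞ := by
  have hp1 : 0 ≤ p - 1 := by linarith
  have h1 : (N : ℝ≥0∞) ^ (p - 1) ≠ ∞ := ENNReal.rpow_ne_top_of_nonneg hp1 (by finiteness)
  have h2 : (2 : ℝ≥0∞) ^ (p - 1) ≠ ∞ := ENNReal.rpow_ne_top_of_nonneg hp1 (by finiteness)
  unfold blendConst localConst partConst ratioConst oscConst meanConst
  finiteness

namespace PDirichletSpace.IsControlled

variable {X : Type*} [MetricSpace X] [MeasurableSpace X] [BorelSpace X]
  {μ : Measure X} {p : ℝ} {D : PDirichletSpace μ p} {Ψ : X → ℝ → ℝ}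
  {CD Ccap CPI Λ CΨ βm βp : ℝ} {x₀ : X} {R a ε Q κ : ℝ} {m n N : ℕ} {I : Finset (ℕ × X)}
  {f : ℕ × X → D.domain} {ψ : ℕ × X → X → ℝ}

lemma exists_isCutoffFamily (h : D.IsControlled Ψ CD Ccap CPI Λ CΨ βm βp)
    (hs : IsWhitneyScale X R a ε Q κ Λ) :
    ∃ (f : ℕ × X → D.domain) (ψ : ℕ × X → X → ℝ), D.IsCutoffFamily Ψ Ccap a ε f ψ := by
  choose f ψ h1 h2 h3 h4 h5 using fun i : ℕ × X => h.exists_cutoff (x := i.2) (hs.adm_radius i)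
  exact ⟨f, ψ, h1, h2, h3, h4, h5⟩

-- A cutoff that meets the tripled ball of `i` has its centre within `8` of its own radii from
-- `i.2`. As `8 ≤ Q`, such cutoffs are counted by the overlap of the dilated balls at the single
-- point `i.2`.
open Classical in
lemma card_neighbors_le (h : D.IsControlled Ψ CD Ccap CPI Λ CΨ βm βp)
    (hs : IsWhitneyScale X R a ε Q κ Λ)
    (hI : IsWhitneyCover (fun y => dist y x₀ - R) a ε m I) (hn : 4 * Q + 1 ≤ 2 ^ n)
    (hN : ENNReal.ofReal CD ^ n ≤ N) (hf : D.IsCutoffFamily Ψ Ccap a ε f ψ) {i : ℕ × X}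
    (hi : i ∈ I) :
    (I.filter fun j => ∃ x ∈ Metric.ball i.2 (3 * whitneyRadius a ε i), ψ j x ≠ 0).card
      ≤ N * 3 := by
  have hδ : ∀ x y, (dist x x₀ - R) - (dist y x₀ - R) ≤ dist x y := fun x y => by
    linarith [dist_triangle x y x₀]
  refine le_trans (Finset.card_le_card ?_) (hI.card_filter_le hδ hs.a_pos hs.ε_pos hs.small
    h.doubling h.ball_ne_zero h.ball_ne_top hn hN i.2)
  intro j hj
  obtain ⟨hj, x, hx, hne⟩ := Finset.mem_filter.1 hj
  refine Finset.mem_filter.2 ⟨hj, ?_⟩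
  have h1 := (hs.areNeighbors hI hδ hi hj hx (hf.supp j x hne)).dist_lt_right
  have h2 := hs.sixteen_le
  have h3 := hs.radius_pos j
  change dist i.2 j.2 < Q * whitneyRadius a ε j
  nlinarith

variable [LinearOrder (ℕ × X)]

lemma gamma_partElem_le_ratio (h : D.IsControlled Ψ CD Ccap CPI Λ CΨ βm βp)
    (hs : IsWhitneyScale X R a ε Q κ Λ)
    (hI : IsWhitneyCover (fun y => dist y x₀ - R) a ε m I) (hn : 4 * Q + 1 ≤ 2 ^ n)
    (hN : ENNReal.ofReal CD ^ n ≤ N) (hf : D.IsCutoffFamily Ψ Ccap a ε f ψ) {i : ℕ × X}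
    (hi : i ∈ I) :
    D.Γ (D.partElem f I i) univ ≤ partConst p CD Ccap CΨ βp (N * 3) *
      (μ (Metric.ball i.2 (whitneyRadius a ε i)) /
        ENNReal.ofReal (Ψ i.2 (whitneyRadius a ε i))) := by
  have hδ : ∀ x y, (dist x x₀ - R) - (dist y x₀ - R) ≤ dist x y := fun x y => by
    linarith [dist_triangle x y x₀]
  have hi0 := hs.radius_pos i
  set r := whitneyRadius a ε i with hr
  have key := gamma_partElem_le (i := i) h.one_lt.le (fun j _ => hf.rep j) hi
    (K := Metric.closedBall i.2 (2 * r)) (U := Metric.ball i.2 (3 * r))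
    Metric.isClosed_closedBall Metric.isOpen_ball
    (Metric.closedBall_subset_ball (by linarith))
    (fun x hx => by
      by_contra hne
      exact hx (hf.supp i x hne).le)
    (h.card_neighbors_le hs hI hn hN hf hi)
    (e := ENNReal.ofReal Ccap * (ratioConst CD CΨ βp * (μ (Metric.ball i.2 r) /
        ENNReal.ofReal (Ψ i.2 r))))
    (fun j hj ⟨x, hx, hne⟩ => by
      refine (hf.energy j).trans ?_
      gcongr
      exact h.ratio_le (hs.adm_radius i) (hs.adm_radius j)
        (hs.areNeighbors hI hδ hi hj hx (hf.supp j x hne)))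
  refine key.trans (le_of_eq ?_)
  rw [partConst]; ring

lemma gamma_blend_ball_le (h : D.IsControlled Ψ CD Ccap CPI Λ CΨ βm βp)
    (hs : IsWhitneyScale X R a ε Q κ Λ)
    (hI : IsWhitneyCover (fun y => dist y x₀ - R) a ε m I) (hn : 4 * Q + 1 ≤ 2 ^ n)
    (hN : ENNReal.ofReal CD ^ n ≤ N) (hf : D.IsCutoffFamily Ψ Ccap a ε f ψ) (u : D.domain)
    {i : ℕ × X} (hi : i ∈ I) :
    D.Γ (D.blend f I (whitneyMean μ (u : Lp ℝ (ENNReal.ofReal p) μ) a ε))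
        (Metric.ball i.2 (3 * whitneyRadius a ε i)) ≤
      localConst p CD Ccap CPI CΨ βp (2 * κ / ε) (N * 3) *
        D.sobolevMeasure (Ψ x₀ R) u (Metric.ball i.2 (Q * whitneyRadius a ε i)) := by
  have hδ : ∀ x y, (dist x x₀ - R) - (dist y x₀ - R) ≤ dist x y := fun x y => by
    linarith [dist_triangle x y x₀]
  have hi0 := hs.radius_pos i
  have ha := hs.a_pos
  have hε := hs.ε_pos
  set r := whitneyRadius a ε i with hr
  set c := whitneyMean μ (u : Lp ℝ (ENNReal.ofReal p) μ) a ε with hc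
  set P := partConst p CD Ccap CΨ βp (N * 3)
  set ν := D.sobolevMeasure (Ψ x₀ R) u (Metric.ball i.2 (Q * r)) with hν
  have hνeq := D.sobolevMeasure_apply (Ψ x₀ R) u (A := Metric.ball i.2 (Q * r))
    Metric.isOpen_ball.measurableSet
  -- Neighbouring parts have energies comparable to `μ(B_i) / Ψ(B_i)`, so only the choice of the
  -- subtracted constant `b` remains.
  suffices hmain : ∃ b : ℝ, (b = 0 ∨ ∀ x ∈ Metric.ball i.2 (3 * r),
      ∑ j ∈ I, truncPart ψ I j x = 1) ∧
      ∀ j ∈ I, (∃ x ∈ Metric.ball i.2 (3 * r), ψ j x ≠ 0) →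
        ‖c j - b‖ₑ ^ p * (μ (Metric.ball i.2 r) / ENNReal.ofReal (Ψ i.2 r)) ≤
        (oscConst CD CPI CΨ βp + meanConst CD CΨ βp (2 * κ / ε)) * ν by
    obtain ⟨b, hb, hbj⟩ := hmain
    have key := gamma_blend_le h.one_lt.le (fun j _ => hf.rep j) c
      (Metric.isOpen_ball (x := i.2) (ε := 3 * r))
      (h.card_neighbors_le hs hI hn hN hf hi) hb
      (e := P * ratioConst CD CΨ βp *
        ((oscConst CD CPI CΨ βp + meanConst CD CΨ βp (2 * κ / ε)) * ν))
      (fun j hj hx => by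
        have h1 := h.gamma_partElem_le_ratio hs hI hn hN hf hj
        have h2 := hbj j hj hx
        obtain ⟨x, hx, hne⟩ := hx
        have h3 := h.ratio_le (hs.adm_radius i) (hs.adm_radius j)
          (hs.areNeighbors hI hδ hi hj hx (hf.supp j x hne))
        calc ‖c j - b‖ₑ ^ p * D.Γ (D.partElem f I j) univ
            ≤ ‖c j - b‖ₑ ^ p * (P * (ratioConst CD CΨ βp *
              (μ (Metric.ball i.2 r) / ENNReal.ofReal (Ψ i.2 r)))) := by
              gcongr
              exact h1.trans (by gcongr)
          _ = P * ratioConst CD CΨ βp * (‖c j - b‖ₑ ^ p *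
              (μ (Metric.ball i.2 r) / ENNReal.ofReal (Ψ i.2 r))) := by ring
          _ ≤ _ := by gcongr)
    refine key.trans (le_of_eq ?_)
    rw [localConst]; ring
  have h16 := hs.sixteen_mul_radius_le i
  have hgap := hI.gap_lt i hi
  rw [← hr] at h16
  by_cases hlev : i.1 = 0
  -- At level zero the tripled ball may leave the covered region, so `b = 0`. The radius is `ε * a`,
  -- and `2 * κ / ε` times it is `2 * (κ * a) ≥ 2 * R`.
  · refine ⟨0, Or.inl rfl, fun j hj ⟨x, hx, hne⟩ => ?_⟩
    have hnb := hs.areNeighbors hI hδ hi hj hx (hf.supp j x hne)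
    have hrr : r = ε * a := by rw [hr, whitneyRadius, hlev, pow_zero, div_one]
    have hK : 2 * κ / ε * r = 2 * (κ * a) := by rw [hrr]; field_simp
    have hRκ := hs.R_le
    have hda := hs.div_le i.1
    have h2a := hs.two_a_le
    have h1 : 1 ≤ 2 * κ / ε := by
      have : 1 * r ≤ 2 * κ / ε * r := by rw [hK]; linarith
      exact le_of_mul_le_mul_right this hi0
    have := h.mean_mul_ratio_le (x₀ := x₀) u hs.adm (hs.adm_radius i) (hs.radius_pos j) hnb h1
      (by rw [← hr, hK]; linarith) (by rw [← hr, hK, dist_comm]; linarith) hs.sixteen_le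
    rw [sub_zero]
    refine this.trans ?_
    rw [hν, hνeq, add_mul, mul_add (meanConst _ _ _ _)]
    exact le_add_left (le_add_left le_rfl)
  · refine ⟨⨍ z in Metric.ball i.2 (16 * r), (u : Lp ℝ (ENNReal.ofReal p) μ) z ∂μ, Or.inr ?_,
      fun j hj ⟨x, hx, hne⟩ => ?_⟩
    · intro x hx
      -- From level one on, `δ` is below `a / 2` at the centre and stays below `a` on the tripled
      -- ball, so the partition sums to one there.
      have h1 := div_two_pow_le ha.le (show 0 + 1 ≤ i.1 by omega)
      have hxd : dist x i.2 < 3 * r := hx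
      obtain ⟨j, hj, hxj⟩ := hI.covers x (by
        have := hδ x i.2
        norm_num at h1
        linarith)
      exact sum_truncPart_eq_one hf.nonneg hj (hf.eq_one j x hxj)
    · have hnb := hs.areNeighbors hI hδ hi hj hx (hf.supp j x hne)
      have := h.osc_mul_ratio_le u (hs.adm_sixteen i) hi0 (hs.radius_pos j) hnb hs.mul_le
      refine this.trans ?_
      rw [hν, hνeq, add_mul, mul_add (oscConst _ _ _ _)]
      exact le_add_right (le_add_right le_rfl)

/-- The energy of the blended function is bounded uniformly in the depth of the cover. -/
lemma gamma_blend_whitney_le (h : D.IsControlled Ψ CD Ccap CPI Λ CΨ βm βp)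
    (hs : IsWhitneyScale X R a ε Q κ Λ)
    (hI : IsWhitneyCover (fun y => dist y x₀ - R) a ε m I) (hn : 4 * Q + 1 ≤ 2 ^ n)
    (hN : ENNReal.ofReal CD ^ n ≤ N) (hf : D.IsCutoffFamily Ψ Ccap a ε f ψ) (u : D.domain) :
    D.Γ (D.blend f I (whitneyMean μ (u : Lp ℝ (ENNReal.ofReal p) μ) a ε)) univ ≤
      blendConst p CD Ccap CPI CΨ βp (2 * κ / ε) (N * 3) *
        D.sobolevMeasure (Ψ x₀ R) u (Metric.ball x₀ (R + 2 * a)) := by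
  classical
  have hδ : ∀ x y, (dist x x₀ - R) - (dist y x₀ - R) ≤ dist x y := fun x y => by
    linarith [dist_triangle x y x₀]
  have h1 := gamma_blend_univ_le (D := D) (fun i (_ : i ∈ I) => hf.rep i)
    (whitneyMean μ (u : Lp ℝ (ENNReal.ofReal p) μ) a ε)
    (K := fun i => Metric.closedBall i.2 (2 * whitneyRadius a ε i))
    (U := fun i => Metric.ball i.2 (3 * whitneyRadius a ε i))
    (fun i _ => Metric.isClosed_closedBall)
    (fun i _ => Metric.closedBall_subset_ball (by linarith [hs.radius_pos i]))
    (fun i _ x hx => by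
      by_contra hne
      exact hx (hf.supp i x hne).le)
  refine h1.trans ((Finset.sum_le_sum fun i hi =>
    h.gamma_blend_ball_le hs hI hn hN hf u hi).trans ?_)
  rw [← Finset.mul_sum, blendConst, mul_assoc]
  gcongr
  -- Energy and `L^p` mass form one measure, so one overlap estimate handles both.
  refine sum_measure_le_of_overlap _ I (fun i _ => Metric.isOpen_ball.measurableSet)
    Metric.isOpen_ball.measurableSet (fun i hi => hs.ball_subset hI hi) fun x => ?_
  have := hI.card_filter_le hδ hs.a_pos hs.ε_pos hs.small
    h.doubling h.ball_ne_zero h.ball_ne_top hn hN x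
  convert this using 3
  exact Iff.rfl

end PDirichletSpace.IsControlled

/-! ### Limits in `L^p` -/

section LpLimit

variable {X : Type*} [MeasurableSpace X] {μ : Measure X} {p : ℝ}

lemma edist_Lp_eq (hp : 0 < p) (f g : Lp ℝ (ENNReal.ofReal p) μ) :
    edist f g = (∫⁻ x, ‖f x - g x‖ₑ ^ p ∂μ) ^ (1 / p) := by
  rw [Lp.edist_def, eLpNorm_eq_lintegral_rpow_enorm_toReal (by simpa using hp) (by simp),
    ENNReal.toReal_ofReal hp.le]
  rfl

lemma exists_Lp_limit (hp : 1 ≤ p) {H : ℕ → Lp ℝ (ENNReal.ofReal p) μ} {b : ℕ → ℝ≥0∞}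
    (hb : Tendsto b atTop (𝓝 0))
    (hH : ∀ k m n, k ≤ m → k ≤ n → ∫⁻ x, ‖H m x - H n x‖ₑ ^ p ∂μ ≤ b k) :
    ∃ h : Lp ℝ (ENNReal.ofReal p) μ, Tendsto (fun n => ‖H n - h‖) atTop (𝓝 0) ∧
      Tendsto (fun n => ∫⁻ x, ‖H n x - h x‖ₑ ^ p ∂μ) atTop (𝓝 0) := by
  have hp0 : 0 < p := by linarith
  have : Fact (1 ≤ ENNReal.ofReal p) := ⟨by rwa [ENNReal.one_le_ofReal]⟩
  have hb' : Tendsto (fun n => b n ^ (1 / p)) atTop (𝓝 0) := by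
    have := (ENNReal.continuous_rpow_const (y := 1 / p)).tendsto 0 |>.comp hb
    rwa [ENNReal.zero_rpow_of_pos (by positivity)] at this
  have hc : CauchySeq H := EMetric.cauchySeq_iff_le_tendsto_0.2
    ⟨fun n => b n ^ (1 / p), fun m n k hm hn => by
      rw [edist_Lp_eq hp0]
      exact ENNReal.rpow_le_rpow (hH k m n hm hn) (by positivity), hb'⟩
  obtain ⟨h, hh⟩ := cauchySeq_tendsto_of_complete hc
  refine ⟨h, tendsto_iff_norm_sub_tendsto_zero.1 hh, ?_⟩
  have h1 := tendsto_iff_edist_tendsto_0.1 hh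
  have h2 := (ENNReal.continuous_rpow_const (y := p)).tendsto 0 |>.comp h1
  rw [ENNReal.zero_rpow_of_pos hp0] at h2
  refine h2.congr fun n => ?_
  rw [Function.comp_apply, edist_Lp_eq hp0, ← ENNReal.rpow_mul, one_div,
    inv_mul_cancel₀ hp0.ne', ENNReal.rpow_one]

lemma ae_eq_on_of_tendsto (hp : 1 ≤ p) {H : ℕ → Lp ℝ (ENNReal.ofReal p) μ}
    {h v : Lp ℝ (ENNReal.ofReal p) μ} {A : Set X} (hA : MeasurableSet A)
    (hh : Tendsto (fun n => ∫⁻ x, ‖H n x - h x‖ₑ ^ p ∂μ) atTop (𝓝 0)) {b : ℕ → ℝ≥0∞}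
    (hb : Tendsto b atTop (𝓝 0)) (hv : ∀ n, ∫⁻ x in A, ‖H n x - v x‖ₑ ^ p ∂μ ≤ b n) :
    ∀ᵐ x ∂μ, x ∈ A → h x = v x := by
  have hp0 : 0 < p := by linarith
  have h2 : (2 : ℝ≥0∞) ^ (p - 1) ≠ ∞ := ENNReal.rpow_ne_top_of_nonneg (by linarith) (by finiteness)
  have hm : ∀ f g : Lp ℝ (ENNReal.ofReal p) μ,
      AEMeasurable (fun x => ‖f x - g x‖ₑ ^ p) μ := fun f g =>
    ((Lp.aestronglyMeasurable f).sub (Lp.aestronglyMeasurable g)).enorm.pow_const p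
  have hle : ∀ n, ∫⁻ x in A, ‖h x - v x‖ₑ ^ p ∂μ ≤
      2 ^ (p - 1) * (∫⁻ x, ‖H n x - h x‖ₑ ^ p ∂μ + b n) := fun n => by
    refine (lintegral_mono fun x => enorm_sub_rpow_le hp _ _ (H n x)).trans ?_
    rw [lintegral_const_mul' _ _ h2]
    simp only [enorm_sub_rev _ (H n _)]
    rw [lintegral_add_left' (hm _ _).restrict]
    gcongr
    · exact Measure.restrict_le_self
    · exact hv n
  have hlim : Tendsto (fun n => (2 : ℝ≥0∞) ^ (p - 1) * (∫⁻ x, ‖H n x - h x‖ₑ ^ p ∂μ + b n))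
      atTop (𝓝 0) := by
    simpa using ENNReal.Tendsto.const_mul (hh.add hb) (Or.inr h2)
  have h0 : ∫⁻ x in A, ‖h x - v x‖ₑ ^ p ∂μ = 0 :=
    le_antisymm (ge_of_tendsto' hlim hle) zero_le
  rw [lintegral_eq_zero_iff' (hm h v).restrict] at h0
  filter_upwards [(ae_restrict_iff' hA).1 h0] with x hx hxA
  have := hx hxA
  simpa [hp0, hp0.not_gt, sub_eq_zero] using this

end LpLimit

/-! ### Approximation near the inner ball -/

/-- Pointwise Jensen inequality for averages with respect to a partition of unity. -/
lemma enorm_sum_sub_rpow_le {ι : Type*} {p : ℝ} (hp : 1 ≤ p) (I : Finset ι) {w c : ι → ℝ}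
    (hw : ∀ i ∈ I, 0 ≤ w i) (hsum : ∑ i ∈ I, w i = 1) (v : ℝ) :
    ‖∑ i ∈ I, c i * w i - v‖ₑ ^ p ≤ ∑ i ∈ I, ENNReal.ofReal (w i) * ‖c i - v‖ₑ ^ p := by
  have h1 : ∑ i ∈ I, c i * w i - v = ∑ i ∈ I, w i * (c i - v) := by
    simp only [mul_sub, Finset.sum_sub_distrib, ← Finset.sum_mul, hsum, one_mul]
    simp only [mul_comm]
  have h2 : ‖∑ i ∈ I, w i * (c i - v)‖ₑ ≤ ∑ i ∈ I, ENNReal.ofReal (w i) * ‖c i - v‖ₑ := by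
    refine (enorm_sum_le _ _).trans (Finset.sum_le_sum fun i hi => ?_)
    rw [enorm_mul, Real.enorm_of_nonneg (hw i hi)]
  rw [h1]
  refine (ENNReal.rpow_le_rpow h2 (by linarith)).trans
    (ENNReal.rpow_arith_mean_le_arith_mean_rpow I _ _ ?_ hp)
  rw [← ENNReal.ofReal_sum_of_nonneg hw, hsum, ENNReal.ofReal_one]

/-- Constant in the `L^p` estimate for the blended function near the inner ball. -/
def approxConst (p CD CPI : ℝ) (N : ℕ) : ℝ≥0∞ :=
  2 ^ (p - 1) * ((ENNReal.ofReal CD ^ 4 + 1) * ENNReal.ofReal CPI) * N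

/-- Upper bound for the scale function on the balls near the inner ball. -/
def scaleBound (CΨ βm βp Ψ₀ R a : ℝ) (k : ℕ) : ℝ≥0∞ :=
  ENNReal.ofReal (CΨ * 2 ^ βp * (a / 2 ^ k / R) ^ βm * Ψ₀)

lemma tendsto_scaleBound (CΨ βp Ψ₀ R a : ℝ) {βm : ℝ} (hβm : 0 < βm) :
    Tendsto (scaleBound CΨ βm βp Ψ₀ R a) atTop (𝓝 0) := by
  have h1 : Tendsto (fun k : ℕ => a / 2 ^ k / R) atTop (𝓝 0) := by
    have h2 : Tendsto (fun k : ℕ => a / 2 ^ k) atTop (𝓝 0) := by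
      have := (tendsto_pow_atTop_nhds_zero_of_lt_one (r := (1 / 2 : ℝ)) (by norm_num)
        (by norm_num)).const_mul a
      simpa [div_eq_mul_inv] using this
    simpa using h2.div_const R
  have h3 := ((Real.continuousAt_rpow_const 0 βm (Or.inr hβm.le)).tendsto.comp h1)
  rw [Real.zero_rpow hβm.ne'] at h3
  have h4 := ENNReal.tendsto_ofReal ((h3.const_mul (CΨ * 2 ^ βp)).mul_const Ψ₀)
  unfold scaleBound
  simpa [Function.comp_def] using h4

namespace PDirichletSpace.IsControlled

variable {X : Type*} [MetricSpace X] [MeasurableSpace X] [BorelSpace X]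
  {μ : Measure X} {p : ℝ} {D : PDirichletSpace μ p} {Ψ : X → ℝ → ℝ}
  {CD Ccap CPI Λ CΨ βm βp : ℝ} {x₀ : X} {R a ε Q κ : ℝ} {k m n N : ℕ} {I J : Finset (ℕ × X)}
  {f : ℕ × X → D.domain} {ψ : ℕ × X → X → ℝ}

/-- Balls of the cover that reach the points at distance less than `2 * (a / 2 ^ k)` from the
inner ball are small. -/
lemma scale_le_scaleBound (h : D.IsControlled Ψ CD Ccap CPI Λ CΨ βm βp)
    (hs : IsWhitneyScale X R a ε Q κ Λ)
    (hI : IsWhitneyCover (fun y => dist y x₀ - R) a ε m I) (hkm : k ≤ m) {i : ℕ × X} (hi : i ∈ I)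
    {y : X} (hy : dist y x₀ - R < 2 * (a / 2 ^ k)) (hyi : dist y i.2 < 2 * whitneyRadius a ε i) :
    ENNReal.ofReal (Ψ i.2 (16 * whitneyRadius a ε i)) ≤ scaleBound CΨ βm βp (Ψ x₀ R) R a k := by
  have h16 := hs.sixteen_mul_radius_le i
  have hgap := hI.gap_lt i hi
  have hle := hI.le_gap i hi
  have ha := hs.a_pos
  have h2a := hs.two_a_le
  have hda := hs.div_le i.1
  have hti : 0 < a / 2 ^ i.1 := by positivity
  -- Below the last level the radius is controlled by `δ` at the centre, hence by `δ y`; at the last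
  -- level it is small because `k ≤ m`.
  have hr : 16 * whitneyRadius a ε i ≤ a / 2 ^ k := by
    rcases (hI.level_le i hi).lt_or_eq with hlt | heq
    · have h1 := hle hlt
      have h2 := dist_triangle_left i.2 x₀ y
      linarith
    · have := div_two_pow_le ha.le (show k + 0 ≤ i.1 by omega)
      simp only [pow_zero, div_one] at this
      linarith
  have hd := h.scale.le_decay h.CΨ_pos h.βm_pos h.βp_pos (x₀ := x₀) (x := i.2)
    (mul_pos (by norm_num) (hs.radius_pos i))
    (show 16 * whitneyRadius a ε i ≤ R by linarith) hs.adm (by rw [dist_comm]; linarith)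
  refine ENNReal.ofReal_le_ofReal (hd.trans ?_)
  have hR := hs.adm.1
  have h1 := h.CΨ_pos
  have h2 := h.βm_pos.le
  have h3 := (h.scale.pos x₀ R hR).le
  have h4 := hs.radius_pos i
  gcongr

variable [LinearOrder (ℕ × X)]

/-- The blended function approximates `u` near the inner ball. -/
lemma lintegral_blend_sub_le (h : D.IsControlled Ψ CD Ccap CPI Λ CΨ βm βp)
    (hs : IsWhitneyScale X R a ε Q κ Λ)
    (hI : IsWhitneyCover (fun y => dist y x₀ - R) a ε m I) (hn : 4 * Q + 1 ≤ 2 ^ n)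
    (hN : ENNReal.ofReal CD ^ n ≤ N) (hf : D.IsCutoffFamily Ψ Ccap a ε f ψ) (u : D.domain)
    (hk : k ≠ 0) (hkm : k ≤ m) :
    ∫⁻ x in Metric.ball x₀ (R + 2 * (a / 2 ^ k)),
      ‖(D.blend f I (whitneyMean μ (u : Lp ℝ (ENNReal.ofReal p) μ) a ε) :
          Lp ℝ (ENNReal.ofReal p) μ) x - (u : Lp ℝ (ENNReal.ofReal p) μ) x‖ₑ ^ p ∂μ ≤
      approxConst p CD CPI (N * 3) * D.Γ u univ * scaleBound CΨ βm βp (Ψ x₀ R) R a k := by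
  classical
  have hp := h.one_lt.le
  have h2 : (2 : ℝ≥0∞) ^ (p - 1) ≠ ∞ := ENNReal.rpow_ne_top_of_nonneg (by linarith) (by finiteness)
  have ha := hs.a_pos
  have hδ : ∀ x y, (dist x x₀ - R) - (dist y x₀ - R) ≤ dist x y := fun x y => by
    linarith [dist_triangle x y x₀]
  set v : X → ℝ := ⇑(u : Lp ℝ (ENNReal.ofReal p) μ) with hv
  set c := whitneyMean μ v a ε with hc
  set E := Metric.ball x₀ (R + 2 * (a / 2 ^ k)) with hE
  set J := I.filter fun i => ∃ x ∈ E, dist x i.2 < 2 * whitneyRadius a ε i with hJ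
  set B : ℕ × X → Set X := fun i => Metric.ball i.2 (16 * whitneyRadius a ε i) with hB
  have hrep := isRep_blend (D := D) (fun i (_ : i ∈ I) => hf.rep i) c
  have hpt : ∀ x ∈ E, ‖∑ i ∈ I, c i * truncPart ψ I i x - v x‖ₑ ^ p ≤
      ∑ i ∈ J, (B i).indicator (fun y => ‖c i - v y‖ₑ ^ p) x := by
    intro x hx
    have hx' : dist x x₀ < R + 2 * (a / 2 ^ k) := hx
    have hxa : dist x x₀ - R < a := by
      -- Since `k ≠ 0`, one has `2 * (a / 2 ^ k) ≤ a`, so `E` lies in the covered region and the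
      -- weights sum to one.
      have := div_two_pow_le ha.le (show 0 + 1 ≤ k by omega)
      norm_num at this
      linarith
    obtain ⟨j, hj, hxj⟩ := hI.covers x hxa
    refine (enorm_sum_sub_rpow_le hp I (fun i _ => truncPart_nonneg hf.nonneg)
      (sum_truncPart_eq_one hf.nonneg hj (hf.eq_one j x hxj)) (v x)).trans ?_
    rw [← Finset.sum_filter_ne_zero]
    have hsupp : ∀ i ∈ I.filter fun i => ENNReal.ofReal (truncPart ψ I i x) *
        ‖c i - v x‖ₑ ^ p ≠ 0, i ∈ J ∧ x ∈ B i := by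
      intro i hi
      obtain ⟨hi, hne⟩ := Finset.mem_filter.1 hi
      have hψ : ψ i x ≠ 0 := fun h0 => hne (by rw [truncPart_eq_zero hi h0]; simp)
      have hd := hf.supp i x hψ
      refine ⟨Finset.mem_filter.2 ⟨hi, x, hx, hd⟩, ?_⟩
      have := hs.radius_pos i
      change dist x i.2 < 16 * whitneyRadius a ε i
      linarith
    refine le_trans (Finset.sum_le_sum fun i hi => ?_)
      (Finset.sum_le_sum_of_subset fun i hi => (hsupp i hi).1)
    rw [indicator_of_mem (hsupp i hi).2]
    refine mul_le_of_le_one_left zero_le ?_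
    rw [← ENNReal.ofReal_one]
    exact ENNReal.ofReal_le_ofReal truncPart_le_one
  have hball : ∀ i ∈ J, ∫⁻ y in B i, ‖c i - v y‖ₑ ^ p ∂μ ≤
      2 ^ (p - 1) * ((ENNReal.ofReal CD ^ 4 + 1) * (ENNReal.ofReal CPI *
        scaleBound CΨ βm βp (Ψ x₀ R) R a k *
        D.Γ u (Metric.ball i.2 (Q * whitneyRadius a ε i)))) := by
    intro i hi
    obtain ⟨hi, x, hx, hd⟩ := Finset.mem_filter.1 hi
    have hr := hs.radius_pos i
    have h1 := h.lintegral_sub_mean_subball_le u (x := i.2) (y := i.2) (hs.adm_sixteen i) hr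
      (Metric.ball_subset_ball (by linarith)) (M := ENNReal.ofReal CD ^ 4)
      (h.doubling.measure_ball_le hr 4 (by rw [dist_self]; norm_num))
    refine h1.trans ?_
    have hx' : dist x x₀ < R + 2 * (a / 2 ^ k) := hx
    have hmono : Metric.ball i.2 (Λ * (16 * whitneyRadius a ε i)) ⊆
        Metric.ball i.2 (Q * whitneyRadius a ε i) :=
      Metric.ball_subset_ball (by nlinarith [hs.mul_le])
    gcongr
    exact h.scale_le_scaleBound hs hI hkm hi (y := x) (by linarith) hd
  have hmeas : ∀ i, AEMeasurable (fun y => ‖c i - v y‖ₑ ^ p) μ := fun i =>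
    (aestronglyMeasurable_const.sub
      (Lp.aestronglyMeasurable (u : Lp ℝ (ENNReal.ofReal p) μ))).enorm.pow_const p
  calc ∫⁻ x in E, ‖(D.blend f I c : Lp ℝ (ENNReal.ofReal p) μ) x - v x‖ₑ ^ p ∂μ
      ≤ ∫⁻ x in E, ∑ i ∈ J, (B i).indicator (fun y => ‖c i - v y‖ₑ ^ p) x ∂μ := by
        refine lintegral_mono_ae ((ae_restrict_iff' Metric.isOpen_ball.measurableSet).2 ?_)
        filter_upwards [hrep] with x hx hxE
        rw [hx]
        exact hpt x hxE
    _ ≤ ∫⁻ x, ∑ i ∈ J, (B i).indicator (fun y => ‖c i - v y‖ₑ ^ p) x ∂μ :=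
        lintegral_mono' Measure.restrict_le_self le_rfl
    _ = ∑ i ∈ J, ∫⁻ y in B i, ‖c i - v y‖ₑ ^ p ∂μ := by
        rw [lintegral_finsetSum' _ fun i _ =>
          (hmeas i).indicator Metric.isOpen_ball.measurableSet]
        exact Finset.sum_congr rfl fun i _ =>
          lintegral_indicator Metric.isOpen_ball.measurableSet _
    _ ≤ ∑ i ∈ I, 2 ^ (p - 1) * ((ENNReal.ofReal CD ^ 4 + 1) * (ENNReal.ofReal CPI *
        scaleBound CΨ βm βp (Ψ x₀ R) R a k *
        D.Γ u (Metric.ball i.2 (Q * whitneyRadius a ε i)))) :=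
        (Finset.sum_le_sum hball).trans
          (Finset.sum_le_sum_of_subset (Finset.filter_subset _ _))
    _ = 2 ^ (p - 1) * ((ENNReal.ofReal CD ^ 4 + 1) * (ENNReal.ofReal CPI *
        scaleBound CΨ βm βp (Ψ x₀ R) R a k *
        ∑ i ∈ I, D.Γ u (Metric.ball i.2 (Q * whitneyRadius a ε i)))) := by
        simp only [Finset.mul_sum]
    _ ≤ 2 ^ (p - 1) * ((ENNReal.ofReal CD ^ 4 + 1) * (ENNReal.ofReal CPI *
        scaleBound CΨ βm βp (Ψ x₀ R) R a k * ((N * 3 : ℕ) * D.Γ u univ))) := by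
        gcongr
        refine sum_measure_le_of_overlap _ I (fun i _ => Metric.isOpen_ball.measurableSet)
          MeasurableSet.univ (fun i _ => subset_univ _) fun x => ?_
        have := hI.card_filter_le hδ hs.a_pos hs.ε_pos hs.small
          h.doubling h.ball_ne_zero h.ball_ne_top hn hN x
        convert this using 3
        exact Iff.rfl
    _ = _ := by rw [approxConst]; ring

/-- Away from the inner ball, blended functions of large depths agree. -/
lemma sum_truncPart_eq_of_le (hs : IsWhitneyScale X R a ε Q κ Λ)
    (hf : D.IsCutoffFamily Ψ Ccap a ε f ψ)
    (hI : IsWhitneyCover (fun y => dist y x₀ - R) a ε m I)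
    (hJ : IsWhitneyCover (fun y => dist y x₀ - R) a ε n J) (hkm : k ≤ m) (hkn : k ≤ n)
    (hIJ : ∀ i, i.1 < m → i.1 < n → (i ∈ I ↔ i ∈ J)) {x : X}
    (hx : x ∉ Metric.ball x₀ (R + 2 * (a / 2 ^ k))) (c : ℕ × X → ℝ) :
    ∑ i ∈ I, c i * truncPart ψ I i x = ∑ i ∈ J, c i * truncPart ψ J i x := by
  -- A cutoff of level at least `k` is supported where `δ < 2 * (a / 2 ^ k)`, so only levels below
  -- `k`, common to both covers, are seen at `x`.
  have key : ∀ {l : ℕ} {K : Finset (ℕ × X)}, IsWhitneyCover (fun y => dist y x₀ - R) a ε l K →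
      ∀ i ∈ K, ψ i x ≠ 0 → i.1 < k := by
    intro l K hK i hi hne
    by_contra! hcon
    apply hx
    have h1 := hf.supp i x hne
    have h2 := hK.gap_lt i hi
    have h3 := hs.sixteen_mul_radius_le i
    have h4 := div_two_pow_le hs.a_pos.le (show k + 0 ≤ i.1 by omega)
    have h5 := dist_triangle x i.2 x₀
    have h6 : 0 < a / 2 ^ i.1 := by have := hs.a_pos; positivity
    simp only [pow_zero, div_one] at h4
    change dist x x₀ < R + 2 * (a / 2 ^ k)
    linarith
  refine sum_truncPart_congr (fun j hne => ⟨fun hj => ?_, fun hj => ?_⟩) c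
  · have := key hI j hj hne
    exact (hIJ j (by omega) (by omega)).1 hj
  · have := key hJ j hj hne
    exact (hIJ j (by omega) (by omega)).2 hj

lemma sum_truncPart_eq_zero_of_notMem (hs : IsWhitneyScale X R a ε Q κ Λ)
    (hf : D.IsCutoffFamily Ψ Ccap a ε f ψ)
    (hI : IsWhitneyCover (fun y => dist y x₀ - R) a ε m I) {x : X}
    (hx : x ∉ Metric.ball x₀ (R + 2 * a)) (c : ℕ × X → ℝ) :
    ∑ i ∈ I, c i * truncPart ψ I i x = 0 := by
  refine Finset.sum_eq_zero fun i hi => ?_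
  rw [truncPart_eq_zero hi, mul_zero]
  by_contra hne
  have h1 := hf.supp i x hne
  refine hx (hs.ball_subset hI hi ?_)
  have := hs.radius_pos i
  have := hs.sixteen_le
  change dist x i.2 < Q * whitneyRadius a ε i
  nlinarith

end PDirichletSpace.IsControlled

/-! ### The Whitney blending theorem -/

namespace PDirichletSpace.IsControlled

variable {X : Type*} [MetricSpace X] [MeasurableSpace X] [BorelSpace X]
  {μ : Measure X} {p : ℝ} {D : PDirichletSpace μ p} {Ψ : X → ℝ → ℝ}
  {CD Ccap CPI Λ CΨ βm βp : ℝ} {x₀ : X} {R a ε Q κ : ℝ} {n N : ℕ}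

lemma lintegral_rpow_lt_top (h : D.IsControlled Ψ CD Ccap CPI Λ CΨ βm βp)
    (u : Lp ℝ (ENNReal.ofReal p) μ) : ∫⁻ x, ‖u x‖ₑ ^ p ∂μ < ∞ := by
  have hp := h.one_lt
  have := lintegral_rpow_enorm_lt_top_of_eLpNorm_lt_top (p := ENNReal.ofReal p)
    (by simp; linarith) (by simp) (Lp.eLpNorm_lt_top u)
  rwa [ENNReal.toReal_ofReal (by linarith)] at this

lemma sobolevMeasure_ne_top (h : D.IsControlled Ψ CD Ccap CPI Λ CΨ βm βp) (u : D.domain)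
    {Ψ₀ : ℝ} (hΨ : 0 < Ψ₀) {A : Set X} (hA : MeasurableSet A) :
    D.sobolevMeasure Ψ₀ u A ≠ ∞ := by
  have := D.finite u
  rw [D.sobolevMeasure_apply _ _ hA]
  refine ENNReal.add_ne_top.2 ⟨measure_ne_top _ _, ENNReal.mul_ne_top ?_ ?_⟩
  · exact ENNReal.inv_ne_top.2 (ENNReal.ofReal_pos.2 hΨ).ne'
  · exact ((setLIntegral_le_lintegral _ _).trans_lt (h.lintegral_rpow_lt_top u)).ne

/-- A function in the domain can be cut off outside a ball, with energy controlled by its energy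
and its `L^p` norm on a larger ball. -/
theorem exists_cutoff_extension (h : D.IsControlled Ψ CD Ccap CPI Λ CΨ βm βp)
    (hs : IsWhitneyScale X R a ε Q κ Λ) (hn : 4 * Q + 1 ≤ 2 ^ n)
    (hN : ENNReal.ofReal CD ^ n ≤ N) (x₀ : X) (u : D.domain) :
    ∃ v : D.domain,
      (∀ᵐ x ∂μ, x ∈ Metric.ball x₀ R →
        (v : Lp ℝ (ENNReal.ofReal p) μ) x = (u : Lp ℝ (ENNReal.ofReal p) μ) x) ∧
      (∀ᵐ x ∂μ, x ∉ Metric.ball x₀ (R + 2 * a) → (v : Lp ℝ (ENNReal.ofReal p) μ) x = 0) ∧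
      ∀ A, MeasurableSet A → D.Γ v A ≤
        blendConst p CD Ccap CPI CΨ βp (2 * κ / ε) (N * 3) *
          D.sobolevMeasure (Ψ x₀ R) u (Metric.ball x₀ (R + 2 * a)) := by
  classical
  -- Any linear order will do, but it must be the same for all depths so that blends agree away from
  -- the inner ball.
  let _ : LinearOrder (ℕ × X) := linearOrderOfSTO WellOrderingRel
  have hp := h.one_lt.le
  have hp0 : 0 < p := by linarith
  have hΨ0 := h.scale.pos x₀ R hs.adm.1
  obtain ⟨f, ψ, hf⟩ := h.exists_isCutoffFamily hs
  obtain ⟨I, hI, hcoh⟩ := exists_isWhitneyCover h.doubling h.ball_ne_zero h.ball_ne_top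
    (δ := fun y => dist y x₀ - R) hs.a_pos hs.ε_pos
    (Metric.isBounded_ball (x := x₀) (r := R + a) |>.subset fun y hy => by
      have hy' : dist y x₀ - R < a := hy
      change dist y x₀ < R + a
      linarith)
  set c := whitneyMean μ (u : Lp ℝ (ENNReal.ofReal p) μ) a ε with hc
  -- The depth is shifted by one because the approximation estimate requires a nonzero level.
  set H : ℕ → D.domain := fun k => D.blend f (I (k + 1)) c with hH
  have hrep : ∀ k, D.IsRep (H k) fun x => ∑ i ∈ I (k + 1), c i * truncPart ψ (I (k + 1)) i x :=
    fun k => isRep_blend (fun i _ => hf.rep i) c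
  set C₁ := approxConst p CD CPI (N * 3) * D.Γ u univ with hC₁
  set S : ℕ → ℝ≥0∞ := fun k => C₁ * scaleBound CΨ βm βp (Ψ x₀ R) R a (k + 1) with hS
  have hC₁top : C₁ ≠ ∞ := by
    have h2 : (2 : ℝ≥0∞) ^ (p - 1) ≠ ∞ :=
      ENNReal.rpow_ne_top_of_nonneg (by linarith) (by finiteness)
    have := D.finite u
    rw [hC₁, approxConst]
    finiteness
  have hS0 : Tendsto S atTop (𝓝 0) := by
    have := (tendsto_scaleBound CΨ βp (Ψ x₀ R) R a h.βm_pos).comp (tendsto_add_atTop_nat 1)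
    simpa using ENNReal.Tendsto.const_mul this (Or.inr hC₁top)
  have happrox : ∀ k m, k ≤ m → ∫⁻ x in Metric.ball x₀ (R + 2 * (a / 2 ^ (k + 1))),
      ‖(H m : Lp ℝ (ENNReal.ofReal p) μ) x - (u : Lp ℝ (ENNReal.ofReal p) μ) x‖ₑ ^ p ∂μ ≤ S k :=
    fun k m hkm => h.lintegral_blend_sub_le hs (hI (m + 1)) hn hN hf u (Nat.succ_ne_zero k)
      (by omega)
  have h2 : (2 : ℝ≥0∞) ^ (p - 1) ≠ ∞ := ENNReal.rpow_ne_top_of_nonneg (by linarith) (by finiteness)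
  have hCauchy : ∀ k m l, k ≤ m → k ≤ l → ∫⁻ x, ‖(H m : Lp ℝ (ENNReal.ofReal p) μ) x -
      (H l : Lp ℝ (ENNReal.ofReal p) μ) x‖ₑ ^ p ∂μ ≤ 2 ^ (p - 1) * (S k + S k) := by
    intro k m l hkm hkl
    -- On `E` both blends are close to `u`; off `E` they coincide.
    set E := Metric.ball x₀ (R + 2 * (a / 2 ^ (k + 1))) with hE
    have hEm : MeasurableSet E := Metric.isOpen_ball.measurableSet
    have hoff : ∫⁻ x in Eᶜ, ‖(H m : Lp ℝ (ENNReal.ofReal p) μ) x -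
        (H l : Lp ℝ (ENNReal.ofReal p) μ) x‖ₑ ^ p ∂μ = 0 := by
      rw [setLIntegral_congr_fun_ae hEm.compl (g := fun _ => 0), lintegral_zero]
      filter_upwards [hrep m, hrep l] with x h1 h3 hx
      rw [h1, h3, sum_truncPart_eq_of_le hs hf (hI (m + 1)) (hI (l + 1)) (k := k + 1)
        (by omega) (by omega) (hcoh _ _) hx c]
      simp [hp0]
    rw [← lintegral_add_compl _ hEm, hoff, add_zero]
    refine (lintegral_mono fun x => enorm_sub_rpow_le hp _ _
      ((u : Lp ℝ (ENNReal.ofReal p) μ) x)).trans ?_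
    rw [lintegral_const_mul' _ _ h2, lintegral_add_left']
    · gcongr
      exacts [happrox k m hkm, happrox k l hkl]
    · exact (((Lp.aestronglyMeasurable _).sub
        (Lp.aestronglyMeasurable _)).enorm.pow_const p).restrict
  obtain ⟨v, hv, hvL⟩ := exists_Lp_limit hp (H := fun k => (H k : Lp ℝ (ENNReal.ofReal p) μ))
    (b := fun k => 2 ^ (p - 1) * (S k + S k))
    (by simpa using ENNReal.Tendsto.const_mul (hS0.add hS0) (Or.inr h2)) hCauchy
  set M := blendConst p CD Ccap CPI CΨ βp (2 * κ / ε) (N * 3) *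
    D.sobolevMeasure (Ψ x₀ R) u (Metric.ball x₀ (R + 2 * a)) with hM
  have hMtop : M ≠ ∞ := ENNReal.mul_ne_top (blendConst_ne_top hp _ _ _ _ _ _ _)
    (h.sobolevMeasure_ne_top u hΨ0 Metric.isOpen_ball.measurableSet)
  have henergy : ∀ k, D.Γ (H k) univ ≤ M := fun k =>
    h.gamma_blend_whitney_le hs (hI (k + 1)) hn hN hf u
  obtain ⟨hmem, hlsc⟩ := D.lowerSemicontinuity v H hv
    ⟨M.toReal, fun k => ENNReal.toReal_mono hMtop (henergy k)⟩
  refine ⟨⟨v, hmem⟩, ?_, ?_, fun A hA => ?_⟩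
  · refine ae_eq_on_of_tendsto hp Metric.isOpen_ball.measurableSet hvL hS0 fun k => ?_
    refine (lintegral_mono_set (Metric.ball_subset_ball ?_)).trans (happrox k k le_rfl)
    have : 0 < a / 2 ^ (k + 1) := by have := hs.a_pos; positivity
    linarith
  · have h0 := ae_eq_on_of_tendsto hp (v := 0) (b := fun _ => 0)
      (A := (Metric.ball x₀ (R + 2 * a))ᶜ) Metric.isOpen_ball.measurableSet.compl hvL
      tendsto_const_nhds fun k => le_of_eq ?_
    · filter_upwards [h0, Lp.coeFn_zero ℝ (ENNReal.ofReal p) μ] with x h1 h3 hx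
      exact (h1 hx).trans h3
    · rw [setLIntegral_congr_fun_ae Metric.isOpen_ball.measurableSet.compl (g := fun _ => 0),
        lintegral_zero]
      filter_upwards [hrep k, Lp.coeFn_zero ℝ (ENNReal.ofReal p) μ] with x h1 h3 hx
      rw [h1, h3, sum_truncPart_eq_zero_of_notMem hs hf (hI (k + 1)) hx c]
      simp [hp0]
  · refine (hlsc A hA).trans ?_
    calc liminf (fun k => D.Γ (H k) A) atTop ≤ liminf (fun _ : ℕ => M) atTop :=
          liminf_le_liminf (Eventually.of_forall fun k =>
            (measure_mono (subset_univ A)).trans (henergy k))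
      _ = M := liminf_const M

/-- Whitney blending of two functions in the domain. -/
theorem exists_blending (h : D.IsControlled Ψ CD Ccap CPI Λ CΨ βm βp)
    (hs : IsWhitneyScale X R a ε Q κ Λ) (hn : 4 * Q + 1 ≤ 2 ^ n)
    (hN : ENNReal.ofReal CD ^ n ≤ N) (x₀ : X) (f g : D.domain) {C : ℝ≥0∞}
    (hC : 2 ^ (p - 1) * (1 + blendConst p CD Ccap CPI CΨ βp (2 * κ / ε) (N * 3) *
      (2 ^ (p - 1) + ENNReal.ofReal CD)) ≤ C) :
    ∃ w : D.domain,
      (∀ᵐ x ∂μ, x ∈ Metric.ball x₀ R →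
        (w : Lp ℝ (ENNReal.ofReal p) μ) x = (f : Lp ℝ (ENNReal.ofReal p) μ) x) ∧
      (∀ᵐ x ∂μ, x ∉ Metric.ball x₀ (R + 2 * a) →
        (w : Lp ℝ (ENNReal.ofReal p) μ) x = (g : Lp ℝ (ENNReal.ofReal p) μ) x) ∧
      D.Γ w (Metric.ball x₀ (2 * R)) ≤
        C * (μ (Metric.ball x₀ R) / ENNReal.ofReal (Ψ x₀ R)) *
            (⨍⁻ x in Metric.ball x₀ (R + 2 * a),
              ‖(f : Lp ℝ (ENNReal.ofReal p) μ) x -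
                (g : Lp ℝ (ENNReal.ofReal p) μ) x‖ₑ ^ p ∂μ) +
          C * D.Γ f (Metric.ball x₀ (2 * R)) + C * D.Γ g (Metric.ball x₀ (2 * R)) := by
  have hp := h.one_lt.le
  have hR := hs.adm.1
  have ha := hs.a_pos
  obtain ⟨v, hv1, hv2, hv3⟩ := h.exists_cutoff_extension hs hn hN x₀ (f - g)
  set K := blendConst p CD Ccap CPI CΨ βp (2 * κ / ε) (N * 3)
  have hsub := Lp.coeFn_sub (f : Lp ℝ (ENNReal.ofReal p) μ) (g : Lp ℝ (ENNReal.ofReal p) μ)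
  have hadd := Lp.coeFn_add (g : Lp ℝ (ENNReal.ofReal p) μ) (v : Lp ℝ (ENNReal.ofReal p) μ)
  refine ⟨g + v, ?_, ?_, ?_⟩
  · filter_upwards [hv1, hsub, hadd] with x h1 h2 h3 hx
    have h1 := h1 hx
    simp only [Submodule.coe_sub, Submodule.coe_add] at *
    rw [h3, Pi.add_apply, h1, h2, Pi.sub_apply]
    ring
  · filter_upwards [hv2, hadd] with x h1 h3 hx
    simp only [Submodule.coe_add] at *
    rw [h3, Pi.add_apply, h1 hx, add_zero]
  · set B := Metric.ball x₀ (2 * R) with hB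
    set Ω := Metric.ball x₀ (R + 2 * a) with hΩ
    have hBm : MeasurableSet B := Metric.isOpen_ball.measurableSet
    have hΩm : MeasurableSet Ω := Metric.isOpen_ball.measurableSet
    -- The condition `2 * a ≤ R` keeps the cutoff region inside `2B₀`, so the energy of `f - g`
    -- there is controlled by the energies of `f` and `g` on `2B₀`.
    have hΩB : Ω ⊆ B := Metric.ball_subset_ball (by linarith [hs.two_a_le])
    have hΩ0 : μ Ω ≠ 0 := h.ball_ne_zero _ _ (by positivity)
    have hΩt : μ Ω ≠ ∞ := h.ball_ne_top _ _
    set q := μ (Metric.ball x₀ R) / ENNReal.ofReal (Ψ x₀ R) with hq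
    set F := ⨍⁻ x in Ω, ‖(f : Lp ℝ (ENNReal.ofReal p) μ) x -
      (g : Lp ℝ (ENNReal.ofReal p) μ) x‖ₑ ^ p ∂μ with hF
    have h1 : D.Γ (f - g) Ω ≤ 2 ^ (p - 1) * (D.Γ f B + D.Γ g B) :=
      (measure_mono hΩB).trans (gamma_sub_le hp f g hBm)
    have h2 : (ENNReal.ofReal (Ψ x₀ R))⁻¹ *
        ∫⁻ z in Ω, ‖((f - g : D.domain) : Lp ℝ (ENNReal.ofReal p) μ) z‖ₑ ^ p ∂μ ≤
        ENNReal.ofReal CD * (q * F) := by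
      have h3 : ∫⁻ z in Ω, ‖((f - g : D.domain) : Lp ℝ (ENNReal.ofReal p) μ) z‖ₑ ^ p ∂μ =
          μ Ω * F := by
        rw [hF, measure_mul_setLAverage _ hΩt]
        refine lintegral_congr_ae (ae_restrict_of_ae ?_)
        filter_upwards [hsub] with x hx
        simp only [Submodule.coe_sub]
        rw [hx, Pi.sub_apply]
      have h4 : μ Ω ≤ ENNReal.ofReal CD * μ (Metric.ball x₀ R) :=
        (measure_mono hΩB).trans (h.doubling x₀ R hR)
      rw [h3, hq, div_eq_mul_inv]
      calc _ ≤ (ENNReal.ofReal (Ψ x₀ R))⁻¹ * (ENNReal.ofReal CD * μ (Metric.ball x₀ R) * F) := by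
            gcongr
        _ = _ := by ring
    have h5 := hv3 B hBm
    rw [D.sobolevMeasure_apply _ _ hΩm] at h5
    have h6 := gamma_add_le hp g v hBm
    set P : ℝ≥0∞ := 2 ^ (p - 1)
    have hC1 : P * (K * ENNReal.ofReal CD) ≤ C := by
      refine le_trans ?_ hC
      gcongr
      exact le_add_left (by gcongr; exact le_add_self)
    have hC2 : P * (K * P) ≤ C := by
      refine le_trans ?_ hC
      gcongr
      exact le_add_left (by gcongr; exact le_self_add)
    have hC3 : P * (1 + K * P) ≤ C := by
      refine le_trans ?_ hC
      gcongr
      exact le_self_add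
    calc D.Γ (g + v) B ≤ P * (D.Γ g B + K * (P * (D.Γ f B + D.Γ g B) +
          ENNReal.ofReal CD * (q * F))) := by
          refine h6.trans ?_
          gcongr
          exact h5.trans (by gcongr)
      _ = P * (K * ENNReal.ofReal CD) * q * F + P * (K * P) * D.Γ f B +
          P * (1 + K * P) * D.Γ g B := by ring
      _ ≤ _ := by gcongr

end PDirichletSpace.IsControlled

end

theorem mainTheorem4
    (p : ℝ) (hp : 1 < p) (η : ℝ) (hη0 : 0 < η) (hη1 : η < 1)
    (Ccap CD CPI Λ CΨ βm βp : ℝ) (hCcap : 0 < Ccap) (hCD : 0 < CD) (hCPI : 0 < CPI)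
    (hΛ : 0 < Λ) (hCΨ : 0 < CΨ) (hβm : 0 < βm) (hβp : 0 < βp) :
    ∃ CWB : ℝ, 0 < CWB ∧
      ∀ (X : Type*) [MetricSpace X] [CompleteSpace X] [LocallyCompactSpace X]
        [TopologicalSpace.SeparableSpace X] [MeasurableSpace X] [BorelSpace X]
        (μ : Measure X) [μ.Regular] (D : PDirichletSpace μ p) (Ψ : X → ℝ → ℝ),
        IsDoublingWith μ CD →
        IsRegularScale Ψ CΨ βm βp →
        D.CapUpperBound Ψ Ccap →
        D.PoincareInequality Ψ CPI Λ →
        ∀ (f g : D.domain) (x₀ : X) (r₀ : ℝ), AdmissibleRadius X r₀ →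
          ∃ h : D.domain,
            (∀ᵐ x ∂μ, x ∈ Metric.ball x₀ r₀ →
              (h : Lp ℝ (ENNReal.ofReal p) μ) x = (f : Lp ℝ (ENNReal.ofReal p) μ) x) ∧
            (∀ᵐ x ∂μ, x ∉ Metric.ball x₀ ((1 + η) * r₀) →
              (h : Lp ℝ (ENNReal.ofReal p) μ) x = (g : Lp ℝ (ENNReal.ofReal p) μ) x) ∧
            D.Γ h (Metric.ball x₀ (2 * r₀)) ≤
              ENNReal.ofReal CWB * (μ (Metric.ball x₀ r₀) / ENNReal.ofReal (Ψ x₀ r₀)) *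
                  (⨍⁻ x in Metric.ball x₀ ((1 + η) * r₀),
                    ‖(f : Lp ℝ (ENNReal.ofReal p) μ) x -
                      (g : Lp ℝ (ENNReal.ofReal p) μ) x‖ₑ ^ p ∂μ) +
                ENNReal.ofReal CWB * D.Γ f (Metric.ball x₀ (2 * r₀)) +
                ENNReal.ofReal CWB * D.Γ g (Metric.ball x₀ (2 * r₀)) := by
  have hL : 1 ≤ max Λ 1 := le_max_right _ _
  -- The Poincaré inequality is used on balls dilated by `16`, so `Q` dominates both `16` and `16 *
  -- Λ`; then `ε` is chosen with `ε * Q = 1 / 8`.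
  set Q : ℝ := 16 * max Λ 1 with hQ
  have hQ0 : 0 < Q := by positivity
  set ε : ℝ := 1 / (8 * Q) with hε
  obtain ⟨n, hn⟩ := pow_unbounded_of_one_lt (4 * Q + 1) one_lt_two
  obtain ⟨N, hN⟩ := ENNReal.exists_nat_gt (r := ENNReal.ofReal CD ^ n) (by finiteness)
  set C : ℝ≥0∞ := 2 ^ (p - 1) * (1 + blendConst p CD Ccap CPI CΨ βp (2 * (2 / η) / ε) (N * 3) *
    (2 ^ (p - 1) + ENNReal.ofReal CD)) with hC
  have hCtop : C ≠ ∞ := by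
    have h1 := blendConst_ne_top hp.le CD Ccap CPI CΨ βp (2 * (2 / η) / ε) (N * 3)
    have h2 : (2 : ℝ≥0∞) ^ (p - 1) ≠ ∞ :=
      ENNReal.rpow_ne_top_of_nonneg (by linarith) (by finiteness)
    rw [hC]
    finiteness
  refine ⟨C.toReal + 1, by positivity, ?_⟩
  intro X _ _ _ _ _ _ μ _ D Ψ hD hΨ hcap hPI f g x₀ r₀ hr₀
  -- Doubling gives balls of positive measure only for `μ ≠ 0`; for the zero measure the element `0`
  -- suffices.
  rcases eq_or_ne μ 0 with rfl | hμ
  · refine ⟨0, by simp, by simp, ?_⟩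
    rw [PDirichletSpace.gamma_zero (by linarith)]
    exact zero_le
  have h : D.IsControlled Ψ CD Ccap CPI Λ CΨ βm βp :=
    ⟨hp, hCΨ, hβm, hβp, hD, hΨ, hcap, hPI, fun x r hr => hD.measure_ball_ne_zero hμ x hr,
      fun x r => hD.measure_ball_ne_top x r⟩
  have hr := hr₀.1
  -- The outer radius `r₀ + 2 * a` must equal `(1 + η) * r₀`, which fixes `a`; then `r₀ = κ * a`
  -- with `κ = 2 / η`, so all constants depend only on the data.
  have hs : IsWhitneyScale X r₀ (η * r₀ / 2) ε Q (2 / η) Λ :=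
    { adm := hr₀
      a_pos := by positivity
      ε_pos := by positivity
      two_a_le := by nlinarith
      sixteen_le := by linarith
      mul_le := by linarith [le_max_left Λ 1]
      small := by rw [hε]; field_simp; norm_num
      R_le := by field_simp; norm_num }
  have hCle : C ≤ ENNReal.ofReal (C.toReal + 1) := by
    rw [ENNReal.le_ofReal_iff_toReal_le hCtop (by positivity)]
    linarith
  have key := h.exists_blending hs hn.le hN.le x₀ f g hCle
  rwa [show r₀ + 2 * (η * r₀ / 2) = (1 + η) * r₀ by ring] at key
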